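/- Let $\mathbb{K}$ be an algebraically closed field of characteristic zero, let $M$ be a lattice (a free abelian group of finite rank), and let $\mathbb{T}=\operatorname{Spec}\mathbb{K}[M]$ be the algebraic torus with character lattice $M$. Let $X$ be an affine $\mathbb{T}$-variety, that is, a normal (integral) affine variety over $\mathbb{K}$ endowed with an effective regular action of $\mathbb{T}$. Below, points are closed points, and sets of points carry the Zariski topology. Suppose that $X$ is endowed with a regular $\mathrm{SL}_2$-action which is compatible, i.e. the image of $\mathrm{SL}_2$ in $\operatorname{Aut}(X)$ is normalized but not centralized by $\mathbb{T}$. The action is said to be of fiber type if the general $\mathrm{SL}_2$-orbits are contained in the $\mathbb{T}$-orbit closures, i.e. there is a dense open subset $W\subseteq X$ with $\mathrm{SL}_2\cdot x\subseteq\overline{\mathbb{T}\cdot x}$ for all $x\in W$. It is said to be special if there is a dense open subset $W\subseteq X$ such that the isotropy group of every point $x\in W$ contains a maximal unipotent subgroup of $\mathrm{SL}_2$. 1. If the compatible $\mathrm{SL}_2$-action is of fiber type, then it is special. 2. In particular, if $X$ is toric, i.e. $\mathbb{T}$ has an open orbit on $X$, then every compatible $\mathrm{SL}_2$-action on $X$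 is special. -/

import Mathlib

open scoped TensorProduct MatrixGroups

/-! Affine varieties over `K` are represented by their coordinate rings: `X = Spec A`, where `A` is
a finitely generated normal domain over `K`. The points of `X` (that is, its closed points) are the
elements of `MaximalSpectrum A` with its Zariski topology. The group `Aut(X)` is identified
with `A ≃ₐ[K] A`: an automorphism `φ` of `X` corresponds to the automorphism `f ↦ f ∘ φ⁻¹` of `A`,
which is an isomorphism of groups. -/

namespace AffineAction

section Points

variable {K A : Type*} [Field K] [CommRing A] [Algebra K A]

/-- The action of `Aut(X) = (A ≃ₐ[K] A)` on the points of `X = Spec A`. A function `f` vanishes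
at `φ • x` if and only if `φ⁻¹ f` (which is the composite of `f` with the automorphism of `X` given
by `φ`) vanishes at `x`. -/
instance pointAction : MulAction (A ≃ₐ[K] A) (MaximalSpectrum A) where
  smul φ x := ⟨x.asIdeal.comap (φ⁻¹ : A ≃ₐ[K] A), Ideal.comap_isMaximal_of_equiv (φ⁻¹ : A ≃ₐ[K] A)⟩
  one_smul x := by
    apply MaximalSpectrum.ext
    ext f
    exact Iff.rfl
  mul_smul φ ψ x := by
    apply MaximalSpectrum.ext
    ext f
    change (φ * ψ)⁻¹ f ∈ x.asIdeal ↔ ψ⁻¹ (φ⁻¹ f) ∈ x.asIdeal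
    rw [mul_inv_rev]
    exact Iff.rfl

theorem mem_smul_iff (φ : A ≃ₐ[K] A) (x : MaximalSpectrum A) (f : A) :
    f ∈ (φ • x).asIdeal ↔ φ⁻¹ f ∈ x.asIdeal := Iff.rfl

/-- Let `G` be an affine algebraic group with coordinate ring `O`, where `ev g : O → K` is the
evaluation of functions at `g ∈ G`. An action `ρ` of the abstract group `G` on `X = Spec A` by
automorphisms is regular if the map `G × X → X`, `(g, x) ↦ g • x`, is a morphism of varieties, i.e.
if there is a comorphism `c : A → O ⊗ A` with `c(f)(g, ·) = f(g • ·)` for all `g ∈ G` and `f ∈ A`.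
-/
def IsRegularAction {G O : Type*} [Group G] [CommRing O] [Algebra K O]
    (ev : G → (O →ₐ[K] K)) (ρ : G →* (A ≃ₐ[K] A)) : Prop :=
  ∃ c : A →ₐ[K] O ⊗[K] A, ∀ (g : G) (f : A),
    Algebra.TensorProduct.lid K A (Algebra.TensorProduct.map (ev g) (AlgHom.id K A) (c f))
      = ρ g⁻¹ f

end Points

section Torus

variable (K M : Type*) [Field K] [AddCommGroup M]

/-- The group of points of the torus `𝕋 = Spec K[M]` with character lattice `M`. -/
abbrev Torus : Type _ := Multiplicative M →* Kˣ

/-- Evaluation of the regular functions on `𝕋 = Spec K[M]` at a point `t`: it maps the character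
`χ^m` to `t m`. -/
noncomputable def torusEval (t : Torus K M) : AddMonoidAlgebra K M →ₐ[K] K :=
  AddMonoidAlgebra.lift K K M ((Units.coeHom K).comp t)

end Torus

section SL2

variable (K : Type*) [Field K]

/-- The coordinate ring `K[x₀₀, x₀₁, x₁₀, x₁₁] / (det - 1)` of `SL₂`. -/
abbrev SL2Ring : Type _ :=
  MvPolynomial (Fin 2 × Fin 2) K ⧸
    Ideal.span {(Matrix.mvPolynomialX (Fin 2) (Fin 2) K).det - 1}

/-- Evaluation of the regular functions on `SL₂` at a point `g`. -/
noncomputable def sl2Eval (g : SL(2, K)) : SL2Ring K →ₐ[K] K :=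
  Ideal.Quotient.liftₐ _ (MvPolynomial.aeval fun ij : Fin 2 × Fin 2 => g ij.1 ij.2) (by
    intro p hp
    have h : Ideal.span {(Matrix.mvPolynomialX (Fin 2) (Fin 2) K).det - 1} ≤
        RingHom.ker (MvPolynomial.aeval fun ij : Fin 2 × Fin 2 => g ij.1 ij.2 :
          MvPolynomial (Fin 2 × Fin 2) K →ₐ[K] K) := by
      rw [Ideal.span_singleton_le_iff_mem, RingHom.mem_ker, map_sub, map_one, sub_eq_zero]
      have hg := g.det_coe
      rw [Matrix.det_fin_two] at hg ⊢
      simpa [Matrix.mvPolynomialX] using hg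
    exact h hp)

variable {K}

/-- A subgroup of `SL₂(K)` is unipotent if all of its elements are unipotent matrices. -/
def IsUnipotentSubgroup (U : Subgroup SL(2, K)) : Prop :=
  ∀ u ∈ U, IsNilpotent ((u : Matrix (Fin 2) (Fin 2) K) - 1)

end SL2

section Notions

variable {K A M : Type*} [Field K] [CommRing A] [Algebra K A] [AddCommGroup M]

/-- An `SL₂`-action `ρ` is compatible with a torus action `τ` if the image of `SL₂` in `Aut(X)` is
normalized but not centralized by the torus. -/
def IsCompatible (τ : Torus K M →* (A ≃ₐ[K] A)) (ρ : SL(2, K) →* (A ≃ₐ[K] A)) : Prop :=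
  τ.range ≤ Subgroup.normalizer (ρ.range : Set (A ≃ₐ[K] A)) ∧
    ¬ τ.range ≤ Subgroup.centralizer (ρ.range : Set (A ≃ₐ[K] A))

/-- The `SL₂`-action `ρ` is of fiber type if the general `SL₂`-orbits are contained in the closures
of the torus orbits. -/
def IsFiberType (τ : Torus K M →* (A ≃ₐ[K] A)) (ρ : SL(2, K) →* (A ≃ₐ[K] A)) : Prop :=
  ∃ W : Set (MaximalSpectrum A), IsOpen W ∧ Dense W ∧
    ∀ x ∈ W, MulAction.orbit ρ.range x ⊆ closure (MulAction.orbit τ.range x)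

/-- The torus action `τ` on `X` has an open orbit. -/
def HasOpenOrbit (τ : Torus K M →* (A ≃ₐ[K] A)) : Prop :=
  ∃ x : MaximalSpectrum A, IsOpen (MulAction.orbit τ.range x)

/-- The isotropy group of the point `x` in `SL₂`. -/
def isotropy (ρ : SL(2, K) →* (A ≃ₐ[K] A)) (x : MaximalSpectrum A) : Subgroup SL(2, K) :=
  (MulAction.stabilizer (A ≃ₐ[K] A) x).comap ρ

/-- An `SL₂`-action is special (horospherical) if there is a dense open subset such that the isotropy
group of each of its points contains a maximal unipotent subgroup of `SL₂`. -/
def IsSpecial (ρ : SL(2, K) →* (A ≃ₐ[K] A)) : Prop :=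
  ∃ W : Set (MaximalSpectrum A), IsOpen W ∧ Dense W ∧
    ∀ x ∈ W, ∃ U : Subgroup SL(2, K), Maximal IsUnipotentSubgroup U ∧ U ≤ isotropy ρ x

end Notions

end AffineAction

/-! Differentiating the `SL₂`-action turns `𝔰𝔩₂` into vector fields `d X` on `X = Spec A`
(`exists_isDifferential`). If `d n` vanishes at `x` for a single nilpotent `n ≠ 0`, the
one-parameter group of `n`, a maximal unipotent subgroup, fixes `x`. So it is enough to find such an
`n` at each point where the `SL₂`-orbit lies in the closure of the torus orbit.

The torus is replaced by one automorphism `θ = τ t₀`, diagonalizable and with only semi-invariants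
as eigenfunctions (`exists_generic_torus_element`). Since `θ` normalizes the image of `SL₂`, it acts
on the tangent fields as conjugation by an element of `SL₂` (`exists_inner`), unless `d` kills `e`,
when there is nothing to do. Diagonalizability of `θ` makes this element diagonalizable, so some
conjugate `E, H, F` of the standard triple is homogeneous (`exists_homogeneous_triple`).

A semi-invariant vanishing at `x` vanishes on the closure of the torus orbit, hence on the
`SL₂`-orbit, so its derivatives vanish at `x`. Thus `(E f)(x) = p(c) f(x)` and `(F f)(x) = q(c)
f(x)` whenever `θ f = c f`. By Leibniz `p` and `q` are additive, so unless `E` or `F` vanishes at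
`x`, they change by constants `P`, `Q` under the weight shift of `E`. Then `[E, F] = H` gives `(H
f)(x) = -(P q + Q p) f(x)`, and `[H, E] = 2E` forces `PQ = -1`. Hence `Q E + H + P F` vanishes at
`x`, and its matrix has determinant `-1 - PQ = 0` (`exists_nilpotent_vanishing`).

In the toric case the open orbit is dense, so the fiber type condition holds on it. -/

namespace AffineAction

/-! ### Nilpotent matrices and unipotent one-parameter subgroups -/

section Nilpotent

variable {K : Type*} [Field K]

/-- The nilpotent cone of `𝔰𝔩₂`. -/
def InNilCone (n : Matrix (Fin 2) (Fin 2) K) : Prop := n.trace = 0 ∧ n.det = 0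

theorem InNilCone.det_one_add {n : Matrix (Fin 2) (Fin 2) K} (hn : InNilCone n) (s : K) :
    (1 + s • n).det = 1 := by
  obtain ⟨h1, h2⟩ := hn
  rw [Matrix.trace_fin_two] at h1
  rw [Matrix.det_fin_two] at h2 ⊢
  simp
  linear_combination s * h1 + s ^ 2 * h2

theorem InNilCone.mul_self {n : Matrix (Fin 2) (Fin 2) K} (hn : InNilCone n) : n * n = 0 := by
  obtain ⟨h1, h2⟩ := hn
  rw [Matrix.trace_fin_two] at h1
  rw [Matrix.det_fin_two] at h2
  ext i j
  fin_cases i <;> fin_cases j <;> simp [Matrix.mul_apply]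
  · linear_combination n 0 0 * h1 - h2
  · linear_combination n 0 1 * h1
  · linear_combination n 1 0 * h1
  · linear_combination n 1 1 * h1 - h2

/-- The one-parameter unipotent subgroup of `SL₂` with tangent vector `n`. -/
def unip (n : Matrix (Fin 2) (Fin 2) K) (hn : InNilCone n) (s : K) : SL(2, K) :=
  ⟨1 + s • n, hn.det_one_add s⟩

theorem coe_unip (n : Matrix (Fin 2) (Fin 2) K) (hn : InNilCone n) (s : K) :
    (unip n hn s : Matrix (Fin 2) (Fin 2) K) = 1 + s • n := rfl

theorem unip_add (n : Matrix (Fin 2) (Fin 2) K) (hn : InNilCone n) (s r : K) :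
    unip n hn (s + r) = unip n hn s * unip n hn r := by
  apply Subtype.ext
  rw [Matrix.SpecialLinearGroup.coe_mul, coe_unip, coe_unip, coe_unip]
  simp only [add_mul, mul_add, one_mul, mul_one, smul_mul_smul_comm, hn.mul_self, smul_zero,
    add_smul, add_zero]
  abel

@[simp] theorem unip_zero (n : Matrix (Fin 2) (Fin 2) K) (hn : InNilCone n) :
    unip n hn 0 = 1 := by
  apply Subtype.ext
  simp [coe_unip]

theorem unip_neg (n : Matrix (Fin 2) (Fin 2) K) (hn : InNilCone n) (s : K) :
    unip n hn (-s) = (unip n hn s)⁻¹ := by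
  rw [eq_inv_iff_mul_eq_one, ← unip_add, neg_add_cancel, unip_zero]

theorem unip_pow (n : Matrix (Fin 2) (Fin 2) K) (hn : InNilCone n) (s : K) (k : ℕ) :
    unip n hn s ^ k = unip n hn (k * s) := by
  induction k with
  | zero => simp
  | succ k ih => rw [pow_succ, ih, ← unip_add]; congr 1; push_cast; ring

/-- The adjoint action of `SL₂` on matrices. -/
def conjMat (g : SL(2, K)) (X : Matrix (Fin 2) (Fin 2) K) : Matrix (Fin 2) (Fin 2) K :=
  (g : Matrix (Fin 2) (Fin 2) K) * X * ((g⁻¹ : SL(2, K)) : Matrix (Fin 2) (Fin 2) K)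

theorem coe_mul_coe_inv (g : SL(2, K)) : (g : Matrix (Fin 2) (Fin 2) K) *
    ((g⁻¹ : SL(2, K)) : Matrix (Fin 2) (Fin 2) K) = 1 := by
  rw [← Matrix.SpecialLinearGroup.coe_mul, mul_inv_cancel, Matrix.SpecialLinearGroup.coe_one]

theorem coe_inv_mul_coe (g : SL(2, K)) : ((g⁻¹ : SL(2, K)) : Matrix (Fin 2) (Fin 2) K) *
    (g : Matrix (Fin 2) (Fin 2) K) = 1 := by
  rw [← Matrix.SpecialLinearGroup.coe_mul, inv_mul_cancel, Matrix.SpecialLinearGroup.coe_one]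

theorem conjMat_add (g : SL(2, K)) (X Y : Matrix (Fin 2) (Fin 2) K) :
    conjMat g (X + Y) = conjMat g X + conjMat g Y := by
  simp [conjMat, mul_add, add_mul]

theorem conjMat_smul (g : SL(2, K)) (a : K) (X : Matrix (Fin 2) (Fin 2) K) :
    conjMat g (a • X) = a • conjMat g X := by
  simp [conjMat]

theorem conjMat_sub (g : SL(2, K)) (X Y : Matrix (Fin 2) (Fin 2) K) :
    conjMat g (X - Y) = conjMat g X - conjMat g Y := by
  simp [conjMat, mul_sub, sub_mul]

theorem conjMat_matMul (g : SL(2, K)) (X Y : Matrix (Fin 2) (Fin 2) K) :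
    conjMat g (X * Y) = conjMat g X * conjMat g Y := by
  simp only [conjMat]
  rw [show (g : Matrix (Fin 2) (Fin 2) K) * X * ((g⁻¹ : SL(2, K)) : Matrix (Fin 2) (Fin 2) K) *
    (g * Y * ((g⁻¹ : SL(2, K)) : Matrix (Fin 2) (Fin 2) K)) =
    g * X * (((g⁻¹ : SL(2, K)) : Matrix (Fin 2) (Fin 2) K) * g) * Y *
      ((g⁻¹ : SL(2, K)) : Matrix (Fin 2) (Fin 2) K) by simp only [mul_assoc], coe_inv_mul_coe]
  simp only [mul_one, mul_assoc]

theorem conjMat_mul (g h : SL(2, K)) (X : Matrix (Fin 2) (Fin 2) K) :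
    conjMat (g * h) X = conjMat g (conjMat h X) := by
  simp only [conjMat, mul_inv_rev, Matrix.SpecialLinearGroup.coe_mul, mul_assoc]

@[simp] theorem conjMat_one (X : Matrix (Fin 2) (Fin 2) K) : conjMat 1 X = X := by
  simp [conjMat]

theorem trace_conjMat (g : SL(2, K)) (X : Matrix (Fin 2) (Fin 2) K) :
    (conjMat g X).trace = X.trace := by
  rw [conjMat, Matrix.trace_mul_comm, ← mul_assoc, coe_inv_mul_coe, one_mul]

theorem det_conjMat (g : SL(2, K)) (X : Matrix (Fin 2) (Fin 2) K) :
    (conjMat g X).det = X.det := by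
  rw [conjMat, Matrix.det_mul, Matrix.det_mul, g.det_coe, (g⁻¹).det_coe, one_mul, mul_one]

theorem InNilCone.conjMat {n : Matrix (Fin 2) (Fin 2) K} (hn : InNilCone n) (g : SL(2, K)) :
    InNilCone (conjMat g n) :=
  ⟨(trace_conjMat g n).trans hn.1, (det_conjMat g n).trans hn.2⟩

theorem unip_conjMat {n : Matrix (Fin 2) (Fin 2) K} (hn : InNilCone n) (g : SL(2, K)) (s : K) :
    unip (AffineAction.conjMat g n) (hn.conjMat g) s = g * unip n hn s * g⁻¹ := by
  apply Subtype.ext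
  rw [Matrix.SpecialLinearGroup.coe_mul, Matrix.SpecialLinearGroup.coe_mul, coe_unip, coe_unip,
    mul_add, add_mul, mul_one, coe_mul_coe_inv]
  simp [AffineAction.conjMat]

theorem conjMat_unip (n : Matrix (Fin 2) (Fin 2) K) (hn : InNilCone n) (s : K)
    (X : Matrix (Fin 2) (Fin 2) K) :
    conjMat (unip n hn s) X = X + s • (n * X - X * n) - s ^ 2 • (n * X * n) := by
  rw [conjMat, ← unip_neg, coe_unip, coe_unip]
  simp only [add_mul, mul_add, one_mul, mul_one, smul_mul_assoc, mul_smul_comm, neg_smul, smul_sub,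
    mul_neg, mul_assoc, smul_smul, pow_two, smul_add]
  abel

variable (K) in
/-- The standard basis vector `e` of `𝔰𝔩₂`. -/
def matE : Matrix (Fin 2) (Fin 2) K := !![0, 1; 0, 0]

variable (K) in
/-- The standard basis vector `h` of `𝔰𝔩₂`. -/
def matH : Matrix (Fin 2) (Fin 2) K := !![1, 0; 0, -1]

variable (K) in
/-- The standard basis vector `f` of `𝔰𝔩₂`. -/
def matF : Matrix (Fin 2) (Fin 2) K := !![0, 0; 1, 0]

theorem matE_nil : InNilCone (matE K) := by simp [InNilCone, matE, Matrix.trace_fin_two]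

theorem matF_nil : InNilCone (matF K) := by simp [InNilCone, matF, Matrix.trace_fin_two]

theorem eq_combination {X : Matrix (Fin 2) (Fin 2) K} (hX : X.trace = 0) :
    X = X 0 1 • matE K + X 0 0 • matH K + X 1 0 • matF K := by
  rw [Matrix.trace_fin_two] at hX
  ext i j
  fin_cases i <;> fin_cases j <;> simp [matE, matH, matF]
  linear_combination hX

/-- Since `h` is not nilpotent, this third matrix is what completes `e`, `f` to a basis of `𝔰𝔩₂`
inside the cone. -/
theorem matHEF_nil : InNilCone (matH K + matE K - matF K) := by
  simp [InNilCone, matE, matH, matF, Matrix.trace_fin_two, Matrix.det_fin_two]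

/-- `𝔰𝔩₂` is spanned by nilpotent matrices. -/
theorem traceless_induction {p : Matrix (Fin 2) (Fin 2) K → Prop} (hnil : ∀ n, InNilCone n → p n)
    (hadd : ∀ X Y, p X → p Y → p (X + Y)) (hsmul : ∀ (a : K) X, p X → p (a • X))
    (X : Matrix (Fin 2) (Fin 2) K) (hX : X.trace = 0) : p X := by
  rw [eq_combination hX]
  have hE := hnil _ (matE_nil (K := K))
  have hF := hnil _ (matF_nil (K := K))
  have hH : p (matH K) := by
    have := hadd _ _ (hadd _ _ (hnil _ (matHEF_nil (K := K))) (hsmul (-1) _ hE)) hF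
    convert this using 1
    module
  exact hadd _ _ (hadd _ _ (hsmul _ _ hE) (hsmul _ _ hH)) (hsmul _ _ hF)

end Nilpotent

/-! ### The differential of a regular `SL₂`-action -/

section Differential

variable {K A : Type*} [Field K] [CommRing A] [Algebra K A]

/-- `d` is the differential of `ρ`: for every nilpotent `n`, the function `s ↦ ρ(1 + s n) f` is
a polynomial whose linear coefficient is `d n f`. -/
def IsDifferential (ρ : SL(2, K) →* (A ≃ₐ[K] A))
    (d : Matrix (Fin 2) (Fin 2) K →ₗ[K] Module.End K A) : Prop :=
  ∀ (n : Matrix (Fin 2) (Fin 2) K) (hn : InNilCone n) (f : A), ∃ p : Polynomial A,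
    (∀ s : K, p.eval (algebraMap K A s) = ρ (unip n hn s) f) ∧ p.coeff 1 = d n f

/-- The algebraic tangent line `s ↦ 1 - s n`, as a homomorphism on the polynomial ring. -/
noncomputable def lineHom (n : Matrix (Fin 2) (Fin 2) K) :
    MvPolynomial (Fin 2 × Fin 2) K →ₐ[K] Polynomial K :=
  MvPolynomial.aeval fun ij => Polynomial.C ((1 : Matrix (Fin 2) (Fin 2) K) ij.1 ij.2) -
    Polynomial.X * Polynomial.C (n ij.1 ij.2)

/-- This is the chain rule at the identity. One choice of `c` and `b` for all `n` is what makes the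
differential linear, although the nilpotent cone is not a linear space. -/
theorem lineHom_coeff (p : MvPolynomial (Fin 2 × Fin 2) K) :
    ∃ (c : K) (b : Fin 2 → Fin 2 → K), ∀ n, (lineHom n p).coeff 0 = c ∧
      (lineHom n p).coeff 1 = ∑ i, ∑ j, n i j * b i j := by
  induction p using MvPolynomial.induction_on with
  | C a => exact ⟨a, 0, fun n => by simp [lineHom, Polynomial.coeff_C]⟩
  | add p q hp hq =>
    obtain ⟨c, b, h⟩ := hp
    obtain ⟨c', b', h'⟩ := hq
    refine ⟨c + c', b + b', fun n => ⟨?_, ?_⟩⟩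
    · rw [map_add, Polynomial.coeff_add, (h n).1, (h' n).1]
    · rw [map_add, Polynomial.coeff_add, (h n).2, (h' n).2]
      simp [Fin.sum_univ_two]
      ring
  | mul_X p ij hp =>
    obtain ⟨c, b, h⟩ := hp
    obtain ⟨i, j⟩ := ij
    refine ⟨c * (1 : Matrix (Fin 2) (Fin 2) K) i j, fun k l =>
      b k l * (1 : Matrix (Fin 2) (Fin 2) K) i j - (if k = i ∧ l = j then c else 0),
      fun n => ⟨?_, ?_⟩⟩
    · rw [map_mul, Polynomial.mul_coeff_zero, (h n).1]
      simp [lineHom]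
    · rw [map_mul, Polynomial.mul_coeff_one, (h n).1, (h n).2]
      fin_cases i <;> fin_cases j <;>
        simp [lineHom, Fin.sum_univ_two, Polynomial.coeff_one] <;> ring

theorem lineHom_det {n : Matrix (Fin 2) (Fin 2) K} (hn : InNilCone n) :
    lineHom n ((Matrix.mvPolynomialX (Fin 2) (Fin 2) K).det - 1) = 0 := by
  obtain ⟨h1, h2⟩ := hn
  rw [Matrix.trace_fin_two] at h1
  rw [Matrix.det_fin_two] at h2
  rw [Matrix.det_fin_two]
  simp [lineHom, Matrix.mvPolynomialX]
  have h1' := congrArg (Polynomial.C (R := K)) h1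
  have h2' := congrArg (Polynomial.C (R := K)) h2
  simp only [map_add, map_sub, map_mul, map_zero] at h1' h2'
  linear_combination -Polynomial.X * h1' + Polynomial.X ^ 2 * h2'

/-- The tangent line `s ↦ 1 - s n` to `SL₂`. -/
noncomputable def sl2Line (n : Matrix (Fin 2) (Fin 2) K) (hn : InNilCone n) :
    SL2Ring K →ₐ[K] Polynomial K :=
  Ideal.Quotient.liftₐ _ (lineHom n) (by
    intro p hp
    have h : Ideal.span {(Matrix.mvPolynomialX (Fin 2) (Fin 2) K).det - 1} ≤
        RingHom.ker (lineHom n) := by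
      rw [Ideal.span_singleton_le_iff_mem, RingHom.mem_ker, lineHom_det hn]
    exact h hp)

theorem eval_sl2Line (n : Matrix (Fin 2) (Fin 2) K) (hn : InNilCone n) (s : K) (p : SL2Ring K) :
    (sl2Line n hn p).eval s = sl2Eval K (unip n hn (-s)) p := by
  obtain ⟨p, rfl⟩ := Ideal.Quotient.mk_surjective p
  change (Polynomial.aeval s : Polynomial K →ₐ[K] K).comp (lineHom n) p =
    MvPolynomial.aeval (fun ij : Fin 2 × Fin 2 => unip n hn (-s) ij.1 ij.2) p
  congr 1
  apply MvPolynomial.algHom_ext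
  intro ij
  simp [lineHom, unip, sub_eq_add_neg]
  ring

/-- Restriction of a family of functions on `X` over `SL₂` to the line `s ↦ 1 - s n`. -/
noncomputable def restrictLine (A : Type*) [CommRing A] [Algebra K A]
    (n : Matrix (Fin 2) (Fin 2) K) (hn : InNilCone n) :
    SL2Ring K ⊗[K] A →ₐ[K] Polynomial A :=
  Algebra.TensorProduct.lift
    ((Polynomial.mapAlgHom (Algebra.ofId K A)).comp (sl2Line n hn))
    (IsScalarTower.toAlgHom K A (Polynomial A)) (fun _ _ => Commute.all _ _)

theorem restrictLine_tmul (n : Matrix (Fin 2) (Fin 2) K) (hn : InNilCone n) (p : SL2Ring K)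
    (a : A) : restrictLine A n hn (p ⊗ₜ a) =
      (sl2Line n hn p).map (algebraMap K A) * Polynomial.C a := by
  simp [restrictLine]

theorem eval_restrictLine (n : Matrix (Fin 2) (Fin 2) K) (hn : InNilCone n) (s : K)
    (w : SL2Ring K ⊗[K] A) :
    (restrictLine A n hn w).eval (algebraMap K A s) = Algebra.TensorProduct.lid K A
      (Algebra.TensorProduct.map (sl2Eval K (unip n hn (-s))) (AlgHom.id K A) w) := by
  induction w with
  | zero => simp
  | add x y hx hy => rw [map_add, Polynomial.eval_add, hx, hy, map_add, map_add]
  | tmul p a =>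
    rw [restrictLine_tmul, Polynomial.eval_mul, Polynomial.eval_C, Polynomial.eval_map_algebraMap,
      Polynomial.aeval_algebraMap_apply_eq_algebraMap_eval, eval_sl2Line]
    simp [Algebra.smul_def]

theorem restrictLine_coeff_one (w : SL2Ring K ⊗[K] A) : ∃ b : Fin 2 → Fin 2 → A,
    ∀ (n : Matrix (Fin 2) (Fin 2) K) (hn : InNilCone n),
      (restrictLine A n hn w).coeff 1 = ∑ i, ∑ j, n i j • b i j := by
  induction w with
  | zero => exact ⟨0, fun n hn => by simp⟩
  | add x y hx hy =>
    obtain ⟨b, h⟩ := hx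
    obtain ⟨b', h'⟩ := hy
    refine ⟨b + b', fun n hn => ?_⟩
    rw [map_add, Polynomial.coeff_add, h, h']
    simp only [Fin.sum_univ_two, Pi.add_apply, smul_add]
    abel
  | tmul p a =>
    obtain ⟨p, rfl⟩ := Ideal.Quotient.mk_surjective p
    obtain ⟨c, b, h⟩ := lineHom_coeff p
    refine ⟨fun i j => b i j • a, fun n hn => ?_⟩
    rw [restrictLine_tmul, Polynomial.coeff_mul_C, Polynomial.coeff_map]
    have := (h n).2
    change (sl2Line n hn (Ideal.Quotient.mk _ p)).coeff 1 = _ at this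
    rw [this]
    simp only [Fin.sum_univ_two, map_add, map_mul, Algebra.smul_def, add_mul, mul_assoc]

/-- A regular action of `SL₂` has a differential. -/
theorem exists_isDifferential {ρ : SL(2, K) →* (A ≃ₐ[K] A)}
    (hρ : IsRegularAction (sl2Eval K) ρ) : ∃ d, IsDifferential ρ d := by
  obtain ⟨c, hc⟩ := hρ
  let D (n : Matrix (Fin 2) (Fin 2) K) (hn : InNilCone n) : Module.End K A :=
    (Polynomial.lcoeff A 1).restrictScalars K ∘ₗ (restrictLine A n hn).toLinearMap ∘ₗ c.toLinearMap
  have hD (n hn) (f : A) : D n hn f = (restrictLine A n hn (c f)).coeff 1 := rfl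
  let E := D _ matE_nil
  let F := D _ matF_nil
  let H := D _ matHEF_nil - E + F
  -- The map is fixed by its values on the basis `e, h, f`, with `h` written as `(h + e - f) - e +
  -- f`. The entry `n 1 1` is ignored, so only values on traceless matrices are meaningful.
  let d : Matrix (Fin 2) (Fin 2) K →ₗ[K] Module.End K A :=
    (Matrix.entryLinearMap K K 0 1).smulRight E + (Matrix.entryLinearMap K K 0 0).smulRight H +
      (Matrix.entryLinearMap K K 1 0).smulRight F
  have hd (n f) : d n f = n 0 1 • E f + n 0 0 • H f + n 1 0 • F f := rfl
  refine ⟨d, fun n hn f => ⟨restrictLine A n hn (c f), fun s => ?_, ?_⟩⟩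
  -- The comorphism at `g` gives `ρ g⁻¹`, which is why the line was taken as `1 - s n`.
  · rw [eval_restrictLine, hc, unip_neg, inv_inv]
  · obtain ⟨b, hb⟩ := restrictLine_coeff_one (c f)
    have hE : E f = b 0 1 := by
      rw [show E f = _ from hD _ _ f, hb]; simp [matE, Fin.sum_univ_two]
    have hF : F f = b 1 0 := by
      rw [show F f = _ from hD _ _ f, hb]; simp [matF, Fin.sum_univ_two]
    have hH : H f = b 0 0 - b 1 1 := by
      change D _ matHEF_nil f - E f + F f = _
      rw [hD, hb, hE, hF]; simp [matE, matF, matH, Fin.sum_univ_two]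
      abel
    have h1 : n 1 1 = - n 0 0 := by
      have := hn.1
      rw [Matrix.trace_fin_two] at this
      linear_combination this
    rw [hb, hd, hE, hF, hH]
    simp only [Fin.sum_univ_two, h1, smul_sub, neg_smul]
    abel

end Differential
-- Tangent fields as locally nilpotent derivations; equivariance and brackets
section OneParameter

variable {K A : Type*} [Field K] [CommRing A] [Algebra K A]

theorem eval_map_algEquiv (φ : A ≃ₐ[K] A) (p : Polynomial A) (s : K) :
    (p.map (φ : A →+* A)).eval (algebraMap K A s) = φ (p.eval (algebraMap K A s)) := by
  have := Polynomial.eval_map_apply (f := (φ : A →+* A)) (p := p) (algebraMap K A s)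
  simpa using this

/-- A polynomial over `A` is determined by its values at an infinite set of elements of `K`. -/
theorem polynomial_ext_of_infinite [IsDomain A] {p q : Polynomial A} {S : Set K} (hS : S.Infinite)
    (h : ∀ s ∈ S, p.eval (algebraMap K A s) = q.eval (algebraMap K A s)) : p = q := by
  apply Polynomial.eq_of_infinite_eval_eq
  refine (hS.image (f := algebraMap K A) ((algebraMap K A).injective.injOn)).mono ?_
  rintro _ ⟨s, hs, rfl⟩
  exact h s hs

theorem polynomial_ext_of_eval [IsDomain A] [Infinite K] {p q : Polynomial A}
    (h : ∀ s : K, p.eval (algebraMap K A s) = q.eval (algebraMap K A s)) : p = q :=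
  polynomial_ext_of_infinite (Set.infinite_univ (α := K)) fun s _ => h s

variable {ρ : SL(2, K) →* (A ≃ₐ[K] A)} {d : Matrix (Fin 2) (Fin 2) K →ₗ[K] Module.End K A}

namespace IsDifferential

variable (hd : IsDifferential ρ d) {n : Matrix (Fin 2) (Fin 2) K} (hn : InNilCone n)
include hd hn

/-- The polynomial `s ↦ ρ(1 + s n) f`. -/
noncomputable def poly (f : A) : Polynomial A := (hd n hn f).choose

theorem eval_poly (f : A) (s : K) :
    (hd.poly hn f).eval (algebraMap K A s) = ρ (unip n hn s) f :=
  (hd n hn f).choose_spec.1 s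

theorem coeff_one_poly (f : A) : (hd.poly hn f).coeff 1 = d n f :=
  (hd n hn f).choose_spec.2

theorem coeff_zero_poly (f : A) : (hd.poly hn f).coeff 0 = f := by
  have := hd.eval_poly hn f 0
  rw [map_zero] at this
  rw [Polynomial.coeff_zero_eq_eval_zero, this, unip_zero, map_one, AlgEquiv.one_apply]

variable [IsDomain A] [Infinite K]

theorem leibniz (f g : A) : d n (f * g) = f * d n g + d n f * g := by
  have h : hd.poly hn (f * g) = hd.poly hn f * hd.poly hn g := by
    apply polynomial_ext_of_eval (K := K)
    intro s
    rw [Polynomial.eval_mul, eval_poly, eval_poly, eval_poly, map_mul]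
  rw [← hd.coeff_one_poly hn, h, Polynomial.mul_coeff_one, coeff_one_poly, coeff_one_poly,
    coeff_zero_poly, coeff_zero_poly]

/-- By the group law, the Taylor expansion at `s` of the polynomial of `f` is `ρ(1 + s n)` applied
to its coefficients; compare linear terms. -/
theorem derivative_poly (f : A) : Polynomial.derivative (hd.poly hn f) = hd.poly hn (d n f) := by
  apply polynomial_ext_of_eval (K := K)
  intro s
  have h : Polynomial.taylor (algebraMap K A s) (hd.poly hn f) =
      (hd.poly hn f).map ((ρ (unip n hn s) : A ≃ₐ[K] A) : A →+* A) := by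
    apply polynomial_ext_of_eval (K := K)
    intro r
    rw [Polynomial.taylor_eval, ← map_add, eval_poly, eval_map_algEquiv, eval_poly, add_comm,
      unip_add, map_mul, AlgEquiv.mul_apply]
  rw [← Polynomial.taylor_coeff_one, h, Polynomial.coeff_map, coeff_one_poly, eval_poly]
  rfl

theorem iterate_derivative_poly (f : A) (k : ℕ) :
    Polynomial.derivative^[k] (hd.poly hn f) = hd.poly hn ((d n ^ k) f) := by
  induction k with
  | zero => simp
  | succ k ih => rw [Function.iterate_succ_apply', ih, derivative_poly, pow_succ',
      Module.End.mul_apply]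

/-- The constant term of the `N`-th derivative is `(d n)^N f`, and derivatives beyond the degree
vanish. -/
theorem locally_nilpotent (f : A) : ∃ N : ℕ, (d n ^ N) f = 0 := by
  refine ⟨(hd.poly hn f).natDegree + 1, ?_⟩
  rw [← hd.coeff_zero_poly hn ((d n ^ _) f), ← iterate_derivative_poly,
    Polynomial.iterate_derivative_eq_zero (Nat.lt_succ_self _), Polynomial.coeff_zero]

/-- The tangent field `d n` commutes with the one-parameter subgroup of `n`. -/
theorem comm_unip (f : A) (s : K) : d n (ρ (unip n hn s) f) = ρ (unip n hn s) (d n f) := by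
  have h : hd.poly hn (ρ (unip n hn s) f) =
      (hd.poly hn f).map ((ρ (unip n hn s) : A ≃ₐ[K] A) : A →+* A) := by
    apply polynomial_ext_of_eval (K := K)
    intro r
    rw [eval_map_algEquiv, eval_poly, eval_poly, ← AlgEquiv.mul_apply, ← AlgEquiv.mul_apply,
      ← map_mul, ← map_mul, ← unip_add, ← unip_add, add_comm]
  rw [← coeff_one_poly hd hn, h, Polynomial.coeff_map, coeff_one_poly]
  rfl

theorem unip_fixed_of_eq_zero [CharZero K] (f : A) (hf : d n f = 0) (s : K) :
    ρ (unip n hn s) f = f := by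
  have : CharZero A := charZero_of_injective_algebraMap (algebraMap K A).injective
  have h0 : hd.poly hn (d n f) = 0 := by
    apply polynomial_ext_of_eval (K := K)
    intro r
    rw [eval_poly, hf, map_zero, Polynomial.eval_zero]
  have h := hd.derivative_poly hn f
  rw [h0] at h
  have h1 := Polynomial.eq_C_of_derivative_eq_zero h
  rw [← eval_poly hd hn, h1, Polynomial.eval_C, coeff_zero_poly]

/-- The elements of a one-parameter unipotent subgroup act locally unipotently. -/
theorem locally_unipotent [CharZero K] (s : K) (f : A) :
    ∃ N : ℕ, (((ρ (unip n hn s)).toLinearMap - 1 : Module.End K A) ^ N) f = 0 := by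
  set U : Module.End K A := (ρ (unip n hn s)).toLinearMap - 1 with hU
  have hcomm : Commute (d n) U := by
    rw [hU]
    refine Commute.sub_right ?_ (Commute.one_right _)
    ext f
    exact hd.comm_unip hn f s
  -- `U` commutes with `d n` and kills its kernel, so it maps the kernel of `(d n)^(N + 1)` into
  -- that of `(d n)^N`.
  have key : ∀ N : ℕ, ∀ f, (d n ^ N) f = 0 → (U ^ N) f = 0 := by
    intro N
    induction N with
    | zero => exact fun f hf => hf
    | succ N ih =>
      intro f hf
      rw [pow_succ, Module.End.mul_apply]
      apply ih
      rw [← Module.End.mul_apply, (hcomm.pow_left N).eq, Module.End.mul_apply]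
      rw [pow_succ', Module.End.mul_apply] at hf
      rw [hU, LinearMap.sub_apply, Module.End.one_apply, sub_eq_zero]
      exact hd.unip_fixed_of_eq_zero hn _ hf s
  obtain ⟨N, hN⟩ := hd.locally_nilpotent hn f
  exact ⟨N, key N f hN⟩

/-- A one-parameter unipotent group of automorphisms is determined by its even integral points. -/
theorem eq_of_conj_pow [CharZero K] (t : A ≃ₐ[K] A) {n' : Matrix (Fin 2) (Fin 2) K}
    (hn' : InNilCone n')
    (h : ∀ k : ℕ, t * ρ (unip n hn (k * 2)) * t⁻¹ = ρ (unip n' hn' (k * 2))) (f : A) :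
    t (d n (t⁻¹ f)) = d n' f := by
  have hp : (hd.poly hn (t⁻¹ f)).map (t : A →+* A) = hd.poly hn' f := by
    refine polynomial_ext_of_infinite (K := K) (S := Set.range fun k : ℕ => (k * 2 : K)) ?_ ?_
    · apply Set.infinite_range_of_injective
      intro a b hab
      simpa using hab
    · rintro _ ⟨k, rfl⟩
      beta_reduce
      rw [eval_map_algEquiv, eval_poly, eval_poly, ← h]
      rfl
  rw [← hd.coeff_one_poly hn', ← hp, Polynomial.coeff_map, coeff_one_poly]
  rfl

theorem map_conjMat_of_nil (g : SL(2, K)) (f : A) :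
    d (conjMat g n) (ρ g f) = ρ g (d n f) := by
  have hp : (hd.poly hn f).map ((ρ g : A ≃ₐ[K] A) : A →+* A) =
      hd.poly (hn.conjMat g) (ρ g f) := by
    apply polynomial_ext_of_eval (K := K)
    intro s
    rw [eval_map_algEquiv, eval_poly, eval_poly, unip_conjMat, map_mul, map_mul,
      AlgEquiv.mul_apply, AlgEquiv.mul_apply, map_inv]
    change _ = ρ g (ρ (unip n hn s) ((ρ g).symm (ρ g f)))
    rw [AlgEquiv.symm_apply_apply]
  rw [← hd.coeff_one_poly (hn.conjMat g), ← hp, Polynomial.coeff_map, coeff_one_poly]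
  rfl

omit hn in
/-- Equivariance of the differential. -/
theorem map_conjMat (g : SL(2, K)) {X : Matrix (Fin 2) (Fin 2) K} (hX : X.trace = 0) (f : A) :
    d (conjMat g X) (ρ g f) = ρ g (d X f) := by
  refine traceless_induction
    (p := fun X => d (conjMat g X) (ρ g f) = ρ g (d X f))
    (fun n hn => hd.map_conjMat_of_nil hn g f) ?_ ?_ X hX
  · intro X Y hX hY
    rw [conjMat_add, map_add, map_add, LinearMap.add_apply, LinearMap.add_apply, hX, hY, map_add]
  · intro a X hX
    rw [conjMat_smul, map_smul, map_smul, LinearMap.smul_apply, LinearMap.smul_apply, hX, map_smul]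

/-- The differential is compatible with Lie brackets. -/
theorem lie_apply {X : Matrix (Fin 2) (Fin 2) K} (hX : X.trace = 0) (f : A) :
    d n (d X f) - d X (d n f) = d (n * X - X * n) f := by
  let ap (Y : Matrix (Fin 2) (Fin 2) K) (p : Polynomial A) : Polynomial A :=
    p.sum fun k a => Polynomial.monomial k (d Y a)
  have hap_coeff (Y p k) : (ap Y p).coeff k = d Y (p.coeff k) := by
    simp only [ap, Polynomial.sum_def, Polynomial.finsetSum_coeff, Polynomial.coeff_monomial]
    rw [Finset.sum_ite_eq' p.support k]
    split_ifs with h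
    · rfl
    · rw [Polynomial.notMem_support_iff.mp h, map_zero]
  have hap_eval (Y p) (s : K) :
      (ap Y p).eval (algebraMap K A s) = d Y (p.eval (algebraMap K A s)) := by
    simp only [ap, Polynomial.sum_def, Polynomial.eval_finsetSum, Polynomial.eval_monomial]
    rw [Polynomial.eval_eq_sum, Polynomial.sum_def, map_sum]
    refine Finset.sum_congr rfl fun k _ => ?_
    rw [← map_pow, mul_comm, ← Algebra.smul_def, mul_comm, ← Algebra.smul_def, map_smul]
  set Y := n * X - X * n with hY
  -- Equivariance along `1 + s n`, with the conjugate of `X` expanded as a quadratic polynomial in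
  -- `s`. The bracket relation is its linear coefficient.
  have hp : hd.poly hn (d X f) = ap X (hd.poly hn f) + Polynomial.X * ap Y (hd.poly hn f) -
      Polynomial.X ^ 2 * ap (n * X * n) (hd.poly hn f) := by
    apply polynomial_ext_of_eval (K := K)
    intro s
    simp only [Polynomial.eval_sub, Polynomial.eval_add, Polynomial.eval_mul, Polynomial.eval_X,
      Polynomial.eval_pow, hap_eval, eval_poly]
    rw [← hd.map_conjMat _ hX, conjMat_unip, map_sub, map_add, map_smul, map_smul]
    simp only [LinearMap.sub_apply, LinearMap.add_apply, LinearMap.smul_apply, ← map_pow,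
      ← Algebra.smul_def]
    rfl
  have h := congrArg (fun p => Polynomial.coeff p 1) hp
  simp only [coeff_one_poly, Polynomial.coeff_sub, Polynomial.coeff_add, hap_coeff,
    Polynomial.coeff_X_mul, Polynomial.coeff_X_pow_mul', coeff_zero_poly] at h
  rw [h]
  simp

end IsDifferential

end OneParameter
-- Conjugacy in `SL₂` and in the nilpotent cone
section Conjugacy

variable {K : Type*} [Field K]

theorem exists_sl2_first_column {x y : K} (h : x ≠ 0 ∨ y ≠ 0) :
    ∃ k : SL(2, K), k 0 0 = x ∧ k 1 0 = y := by
  by_cases hx : x = 0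
  · have hy := h.resolve_left (not_not.mpr hx)
    refine ⟨⟨!![0, -y⁻¹; y, 0], ?_⟩, ?_, ?_⟩
    · rw [Matrix.det_fin_two_of]; field_simp; ring
    · simp [hx]
    · simp
  · refine ⟨⟨!![x, 0; y, x⁻¹], ?_⟩, ?_, ?_⟩
    · rw [Matrix.det_fin_two_of]; field_simp; ring
    · simp
    · simp

theorem coe_inv_sl2 (g : SL(2, K)) : ((g⁻¹ : SL(2, K)) : Matrix (Fin 2) (Fin 2) K) =
    !![g 1 1, -g 0 1; -g 1 0, g 0 0] := by
  rw [Matrix.SpecialLinearGroup.coe_inv, Matrix.adjugate_fin_two]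

theorem sl2_det (g : SL(2, K)) : g 0 0 * g 1 1 - g 0 1 * g 1 0 = 1 := by
  rw [← Matrix.det_fin_two]
  exact g.det_coe

theorem conjMat_matE (g : SL(2, K)) : conjMat g (matE K) =
    !![-(g 0 0 * g 1 0), g 0 0 ^ 2; -(g 1 0) ^ 2, g 0 0 * g 1 0] := by
  rw [conjMat, coe_inv_sl2, matE]
  ext i j
  fin_cases i <;> fin_cases j <;> simp [Matrix.mul_apply, Fin.sum_univ_two] <;> ring

theorem conjMat_matF (g : SL(2, K)) : conjMat g (matF K) =
    !![g 0 1 * g 1 1, -(g 0 1) ^ 2; g 1 1 ^ 2, -(g 0 1 * g 1 1)] := by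
  rw [conjMat, coe_inv_sl2, matF]
  ext i j
  fin_cases i <;> fin_cases j <;> simp [Matrix.mul_apply, Fin.sum_univ_two] <;> ring

theorem conjMat_matH (g : SL(2, K)) : conjMat g (matH K) =
    !![g 0 0 * g 1 1 + g 0 1 * g 1 0, -(2 * g 0 0 * g 0 1);
      2 * g 1 0 * g 1 1, -(g 0 0 * g 1 1 + g 0 1 * g 1 0)] := by
  rw [conjMat, coe_inv_sl2, matH]
  ext i j
  fin_cases i <;> fin_cases j <;> simp [Matrix.mul_apply, Fin.sum_univ_two] <;> ring

variable [IsAlgClosed K]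

/-- All nonzero nilpotent matrices are conjugate under `SL₂`. -/
theorem InNilCone.exists_eq_conjMat {n : Matrix (Fin 2) (Fin 2) K} (hn : InNilCone n)
    (h0 : n ≠ 0) : ∃ g : SL(2, K), n = AffineAction.conjMat g (matE K) := by
  obtain ⟨h1, h2⟩ := hn
  rw [Matrix.trace_fin_two] at h1
  rw [Matrix.det_fin_two] at h2
  have h11 : n 1 1 = -n 0 0 := by linear_combination h1
  obtain ⟨x, hx⟩ := IsAlgClosed.exists_pow_nat_eq (n 0 1) (n := 2) two_pos
  obtain ⟨y, hy, hxy⟩ : ∃ y : K, -y ^ 2 = n 1 0 ∧ -(x * y) = n 0 0 := by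
    by_cases hx0 : x = 0
    · obtain ⟨y, hy⟩ := IsAlgClosed.exists_pow_nat_eq (-n 1 0) (n := 2) two_pos
      refine ⟨y, by rw [hy, neg_neg], ?_⟩
      have : n 0 0 ^ 2 = 0 := by
        rw [hx0] at hx
        rw [h11, ← hx] at h2
        linear_combination -h2
      rw [hx0, pow_eq_zero_iff (two_ne_zero) |>.mp this]
      simp
    · refine ⟨-n 0 0 / x, ?_, by field_simp⟩
      field_simp
      rw [h11] at h2
      rw [hx]
      linear_combination h2
  obtain ⟨g, hg0, hg1⟩ : ∃ k : SL(2, K), k 0 0 = x ∧ k 1 0 = y := by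
    apply exists_sl2_first_column
    by_contra! h
    apply h0
    rw [h.1] at hx hxy
    rw [h.2] at hy hxy
    have h00 : n 0 0 = 0 := by rw [← hxy]; simp
    ext i j
    fin_cases i <;> fin_cases j
    · exact h00
    · simpa using hx.symm
    · simpa using hy.symm
    · simpa [h00] using h11
  refine ⟨g, ?_⟩
  rw [conjMat_matE, hg0, hg1]
  ext i j
  fin_cases i <;> fin_cases j
  · exact hxy.symm
  · exact hx.symm
  · exact hy.symm
  · simp [h11, ← hxy]

/-- Up to conjugation, an element of `SL₂` is upper triangular, and is even diagonal if its
eigenvalues are distinct. -/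
theorem exists_conj_triangular (g : SL(2, K)) : ∃ k h : SL(2, K), g = k * h * k⁻¹ ∧ h 1 0 = 0 ∧
    (h 0 0 = h 1 1 ∨ h 0 1 = 0) := by
  obtain ⟨k, hk⟩ : ∃ k : SL(2, K), (k⁻¹ * g * k) 1 0 = 0 := by
    obtain ⟨c, hc⟩ := IsAlgClosed.exists_root
      (Matrix.charpoly (g : Matrix (Fin 2) (Fin 2) K)) (by
        rw [Matrix.charpoly_degree_eq_dim]; simp)
    rw [Polynomial.IsRoot, Matrix.eval_charpoly] at hc
    obtain ⟨v, hv0, hv⟩ := Matrix.exists_mulVec_eq_zero_iff.mpr hc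
    obtain ⟨k, hk0, hk1⟩ : ∃ k : SL(2, K), k 0 0 = v 0 ∧ k 1 0 = v 1 := by
      apply exists_sl2_first_column
      by_contra! h
      apply hv0
      ext i
      fin_cases i
      · exact h.1
      · exact h.2
    refine ⟨k, ?_⟩
    have e0 := congrFun hv 0
    have e1 := congrFun hv 1
    simp [Matrix.mulVec, dotProduct, Fin.sum_univ_two] at e0 e1
    change ((k⁻¹ * g * k : SL(2, K)) : Matrix (Fin 2) (Fin 2) K) 1 0 = 0
    rw [Matrix.SpecialLinearGroup.coe_mul, Matrix.SpecialLinearGroup.coe_mul, coe_inv_sl2]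
    simp [Matrix.mul_apply, Matrix.vecMul, dotProduct, Fin.sum_univ_two, hk0, hk1]
    linear_combination v 1 * e0 - v 0 * e1
  set h := k⁻¹ * g * k with hh
  have hg : g = k * h * k⁻¹ := by rw [hh]; group
  by_cases heq : h 0 0 = h 1 1
  · exact ⟨k, h, hg, hk, Or.inl heq⟩
  · have hsub : h 1 1 - h 0 0 ≠ 0 := sub_ne_zero.mpr (Ne.symm heq)
    let u := unip (matE K) matE_nil (h 0 1 / (h 1 1 - h 0 0))
    refine ⟨k * u, u⁻¹ * h * u, by rw [hg]; group, ?_, Or.inr ?_⟩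
    · rw [Matrix.SpecialLinearGroup.coe_mul, Matrix.SpecialLinearGroup.coe_mul, ← unip_neg,
        coe_unip, coe_unip, matE]
      simp [Matrix.mul_apply, Fin.sum_univ_two, hk]
    · rw [Matrix.SpecialLinearGroup.coe_mul, Matrix.SpecialLinearGroup.coe_mul, ← unip_neg,
        coe_unip, coe_unip, matE]
      simp [Matrix.mul_apply, Fin.sum_univ_two, hk]
      field_simp
      ring

end Conjugacy

/-! ### Automorphisms normalizing `SL₂` act by inner automorphisms -/

section Inner

variable {K A : Type*} [Field K] [CommRing A] [Algebra K A]

/-- A locally unipotent automorphism has no eigenvectors of eigenvalue `a ≠ 1` on endomorphisms. -/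
theorem eq_zero_of_locally_unipotent {φ D : Module.End K A} {a : K} (ha : a ≠ 1)
    (hφ : ∀ f, ∃ N : ℕ, ((φ - 1) ^ N) f = 0) (hD : ∀ f, φ (D f) = a • D (φ f)) : D = 0 := by
  have hinj : ∀ y, φ y = a • y → y = 0 := by
    intro y hy
    obtain ⟨N, hN⟩ := hφ y
    have : ∀ k : ℕ, ((φ - 1) ^ k) y = (a - 1) ^ k • y := by
      intro k
      induction k with
      | zero => simp
      | succ k ih =>
        rw [pow_succ', Module.End.mul_apply, ih, map_smul, LinearMap.sub_apply, hy,
          Module.End.one_apply, pow_succ, mul_smul, sub_smul, one_smul]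
    rw [this] at hN
    exact (smul_eq_zero.mp hN).resolve_left (pow_ne_zero _ (sub_ne_zero.mpr ha))
  -- By induction `D` kills `(φ - 1) f`; then `D f` is an eigenvector of `φ` for `a ≠ 1`, hence
  -- zero.
  have key : ∀ N : ℕ, ∀ f, ((φ - 1) ^ N) f = 0 → D f = 0 := by
    intro N
    induction N with
    | zero => exact fun f hf => by rw [show f = 0 from hf, map_zero]
    | succ N ih =>
      intro f hf
      rw [pow_succ, Module.End.mul_apply] at hf
      have h1 := ih _ hf
      rw [LinearMap.sub_apply, Module.End.one_apply, map_sub, sub_eq_zero] at h1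
      apply hinj
      rw [hD, h1]
  ext f
  obtain ⟨N, hN⟩ := hφ f
  exact key N f hN

variable [IsDomain A] [IsAlgClosed K] {ρ : SL(2, K) →* (A ≃ₐ[K] A)}
  {d : Matrix (Fin 2) (Fin 2) K →ₗ[K] Module.End K A}

theorem IsDifferential.conjMat_ne_zero (hd : IsDifferential ρ d) (hE : d (matE K) ≠ 0)
    (g : SL(2, K)) : d (conjMat g (matE K)) ≠ 0 := by
  intro h
  apply hE
  ext f
  have h1 := hd.map_conjMat g matE_nil.1 f
  rw [h] at h1
  exact (map_eq_zero_iff _ (ρ g).injective).mp h1.symm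

variable [CharZero K]

/-- An automorphism that normalizes the image of `SL₂` permutes the tangent fields of its
one-parameter unipotent subgroups. -/
theorem IsDifferential.exists_conj_nil (hd : IsDifferential ρ d) (hE : d (matE K) ≠ 0)
    {t : A ≃ₐ[K] A} (ht : ∀ g, ∃ g', t * ρ g * t⁻¹ = ρ g') {n : Matrix (Fin 2) (Fin 2) K}
    (hn : InNilCone n) : ∃ n', InNilCone n' ∧ ∀ f, t (d n f) = d n' (t f) := by
  -- Only the image of `SL₂` is normalized and `ρ` may have a kernel, so `g` is merely some
  -- preimage; its Jordan type must be read off from the action on `A`.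
  obtain ⟨g, hg⟩ := ht (unip n hn 1)
  obtain ⟨k, h, rfl, h10, hcases⟩ := exists_conj_triangular g
  have hdet := sl2_det h
  rw [h10, mul_zero, sub_zero] at hdet
  by_cases heq : h 0 0 = h 1 1
  -- Equal eigenvalues are both `1` or both `-1`. Squaring removes the sign, which is why only even
  -- times are compared.
  · have hsq : h ^ 2 = unip (matE K) matE_nil (2 * (h 0 0 * h 0 1)) := by
      apply Subtype.ext
      rw [pow_two, Matrix.SpecialLinearGroup.coe_mul, coe_unip, matE]
      rw [← heq] at hdet
      ext i j
      fin_cases i <;> fin_cases j <;>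
        simp [Matrix.mul_apply, Fin.sum_univ_two, h10, ← heq, hdet]
      ring
    have hn0 : InNilCone ((h 0 0 * h 0 1) • matE K) := by
      constructor <;> simp [matE, Matrix.trace_fin_two, Matrix.det_fin_two]
    have hn' := hn0.conjMat k
    have hsq' : (k * h * k⁻¹) ^ 2 = unip _ hn' 2 := by
      rw [conj_pow, hsq, unip_conjMat hn0]
      congr 2
      apply Subtype.ext
      rw [coe_unip, coe_unip, smul_smul]
    refine ⟨_, hn', fun f => ?_⟩
    rw [← hd.eq_of_conj_pow hn t hn' (fun j => ?_)]
    · change _ = t (d n (t.symm (t f)))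
      rw [AlgEquiv.symm_apply_apply]
    · have h1 : unip n hn (j * 2) = unip n hn 1 ^ (2 * j) := by
        rw [unip_pow]; congr 1; push_cast; ring
      rw [h1, map_pow, ← conj_pow, hg, pow_mul, ← map_pow, hsq', ← map_pow, unip_pow]
  -- With distinct eigenvalues, `g` would scale the field of `k e k⁻¹` by `h 0 0 ^ 2 ≠ 1`,
  -- impossible for a locally unipotent automorphism unless the field is zero.
  · exfalso
    have h01 := hcases.resolve_left heq
    apply hd.conjMat_ne_zero hE k
    refine eq_zero_of_locally_unipotent (φ := (ρ (k * h * k⁻¹)).toLinearMap) (a := h 0 0 ^ 2)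
      ?_ ?_ ?_
    · intro h1
      apply heq
      have h2 : h 0 0 ≠ 0 := left_ne_zero_of_mul_eq_one hdet
      apply mul_left_cancel₀ h2
      rw [hdet, ← pow_two, h1]
    · intro f
      obtain ⟨N, hN⟩ := hd.locally_unipotent hn 1 (t⁻¹ f)
      refine ⟨N, ?_⟩
      have key : ∀ (N : ℕ) f, ((((ρ (k * h * k⁻¹)).toLinearMap - 1 : Module.End K A)) ^ N) (t f) =
          t ((((ρ (unip n hn 1)).toLinearMap - 1 : Module.End K A) ^ N) f) := by
        intro N
        induction N with
        | zero => intro f; rfl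
        | succ N ih =>
          intro f
          rw [pow_succ, pow_succ, Module.End.mul_apply, Module.End.mul_apply, ← ih]
          congr 1
          rw [LinearMap.sub_apply, LinearMap.sub_apply, map_sub, ← hg]
          change t (ρ _ (t.symm (t f))) - t f = _
          rw [AlgEquiv.symm_apply_apply]
          rfl
      have hf : t (t⁻¹ f) = f := t.apply_symm_apply f
      rw [← hf, key, hN, map_zero]
    · intro f
      change ρ (k * h * k⁻¹) _ = _ • d _ (ρ (k * h * k⁻¹) f)
      rw [← hd.map_conjMat _ (matE_nil.conjMat k).1, ← conjMat_mul, inv_mul_cancel_right,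
        conjMat_mul]
      have : conjMat h (matE K) = h 0 0 ^ 2 • matE K := by
        rw [conjMat_matE, h10, matE]
        ext i j
        fin_cases i <;> fin_cases j <;> simp
      rw [this, conjMat_smul, map_smul]
      rfl

/-- An automorphism that normalizes the image of `SL₂` acts on the tangent fields of the
`SL₂`-action as an element of `SL₂`. -/
theorem IsDifferential.exists_inner (hd : IsDifferential ρ d) (hE : d (matE K) ≠ 0)
    {t : A ≃ₐ[K] A} (ht : ∀ g, ∃ g', t * ρ g * t⁻¹ = ρ g') :
    ∃ g : SL(2, K), ∀ X : Matrix (Fin 2) (Fin 2) K, X.trace = 0 →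
      ∀ f, t (d X f) = d (conjMat g X) (t f) := by
  obtain ⟨n₁, hn₁, h1⟩ := hd.exists_conj_nil hE ht matE_nil
  have hn₁0 : n₁ ≠ 0 := by
    rintro rfl
    apply hE
    ext f
    have := h1 f
    rw [map_zero, LinearMap.zero_apply] at this
    exact (map_eq_zero_iff _ t.injective).mp this
  obtain ⟨g, rfl⟩ := hn₁.exists_eq_conjMat hn₁0
  -- `t'` commutes with the tangent field of `matE`
  obtain ⟨t', htt'⟩ : ∃ t', t = ρ g * t' := ⟨(ρ g)⁻¹ * t, by rw [mul_inv_cancel_left]⟩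
  have ht'norm : ∀ x, ∃ x', t' * ρ x * t'⁻¹ = ρ x' := by
    intro x
    obtain ⟨x', hx'⟩ := ht x
    refine ⟨g⁻¹ * x' * g, ?_⟩
    rw [map_mul ρ, map_mul ρ, ← hx', map_inv ρ, htt']
    group
  have hE' : ∀ f, t' (d (matE K) f) = d (matE K) (t' f) := by
    intro f
    apply (ρ g).injective
    rw [← hd.map_conjMat g matE_nil.1, ← AlgEquiv.mul_apply, ← AlgEquiv.mul_apply, ← htt', h1]
  -- `t'` fixes the field of `e` and sends that of `f` to that of `n`. The relation `[e, [e, f]] =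
  -- -2e` forces `n 1 0 = 1`, and nilpotency then leaves only `n = u f u⁻¹` with `u = 1 + n 0 0 •
  -- e`.
  obtain ⟨n, hn, hF'⟩ := hd.exists_conj_nil hE ht'norm matF_nil
  have hEF : matE K * matF K - matF K * matE K = matH K := by
    ext i j
    fin_cases i <;> fin_cases j <;> simp [matE, matF, matH]
  have hEH : matE K * matH K - matH K * matE K = (-2 : K) • matE K := by
    ext i j
    fin_cases i <;> fin_cases j <;> simp [matE, matH]
    norm_num
  have hH0 : (matH K).trace = 0 := by simp [matH, Matrix.trace_fin_two]
  set Z := matE K * n - n * matE K with hZ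
  have hZ0 : Z.trace = 0 := by
    rw [hZ, Matrix.trace_sub, Matrix.trace_mul_comm, sub_self]
  have h11 : n 1 1 = -n 0 0 := by
    have := hn.1
    rw [Matrix.trace_fin_two] at this
    linear_combination this
  have hEZ : matE K * Z - Z * matE K = (-2 * n 1 0) • matE K := by
    rw [hZ]
    ext i j
    fin_cases i <;> fin_cases j <;>
      simp [matE, Matrix.mul_apply, Matrix.vecMul, dotProduct, Fin.sum_univ_two]
    ring
  have hH' : ∀ f, t' (d (matH K) f) = d Z (t' f) := by
    intro f
    rw [← hEF, ← hd.lie_apply matE_nil matF_nil.1, map_sub, hE', hF', hF', hE',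
      hd.lie_apply matE_nil hn.1]
  have hn10 : n 1 0 = 1 := by
    obtain ⟨f, hf⟩ : ∃ f, d (matE K) f ≠ 0 := by
      by_contra! h
      exact hE (LinearMap.ext h)
    have h2 := congrArg t' (hd.lie_apply matE_nil hH0 f)
    rw [hEH, map_sub, hE', hH', hH', hE', hd.lie_apply matE_nil hZ0, hEZ, map_smul, map_smul,
      LinearMap.smul_apply, LinearMap.smul_apply, map_smul, ← hE'] at h2
    have h3 : t' (d (matE K) f) ≠ 0 := (map_ne_zero_iff _ t'.injective).mpr hf
    have h4 := smul_left_injective K h3 h2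
    have h5 : (-2 : K) ≠ 0 := neg_ne_zero.mpr two_ne_zero
    apply mul_left_cancel₀ h5
    rw [mul_one]
    exact h4
  set u := unip (matE K) matE_nil (n 0 0) with hu
  have hu_coe : (u : Matrix (Fin 2) (Fin 2) K) = !![1, n 0 0; 0, 1] := by
    rw [hu, coe_unip, matE]
    ext i j
    fin_cases i <;> fin_cases j <;> simp
  have hn01 : n 0 1 = -n 0 0 ^ 2 := by
    have := hn.2
    rw [Matrix.det_fin_two, h11, hn10] at this
    linear_combination -this
  have huE : conjMat u (matE K) = matE K := by
    rw [conjMat_matE, hu_coe, matE]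
    ext i j
    fin_cases i <;> fin_cases j <;> simp
  have huF : conjMat u (matF K) = n := by
    rw [conjMat_matF, hu_coe]
    ext i j
    fin_cases i <;> fin_cases j <;> simp [h11, hn10, hn01]
  have huH : conjMat u (matH K) = Z := by
    rw [← hEF, conjMat_sub, conjMat_matMul, conjMat_matMul, huE, huF]
  refine ⟨g * u, fun X hX f => ?_⟩
  have h6 : t' (d X f) = d (conjMat u X) (t' f) := by
    rw [eq_combination hX]
    simp only [conjMat_add, conjMat_smul, huE, huF, huH, map_add, map_smul, LinearMap.add_apply,
      LinearMap.smul_apply, hE', hF', hH']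
  rw [htt', AlgEquiv.mul_apply, AlgEquiv.mul_apply, h6, conjMat_mul,
    hd.map_conjMat g ((trace_conjMat u X).trans hX)]

end Inner
-- A homogeneous triple at a point: the pointwise core
section Horospherical

variable {K A : Type*} [Field K] [CommRing A] [Algebra K A]

/-- Suppose `D` is a derivation that shifts the eigenspaces of an automorphism `θ`, and that at the
point `ev` its value on an eigenfunction depends only on the value of the function. Then the
dependence is given by an additive function of the eigenvalue. -/
theorem exists_eigenvalue_functional (ev : A →ₐ[K] K) (θ : A ≃ₐ[K] A) (D : Module.End K A)
    (hD : ∀ f g, D (f * g) = f * D g + D f * g)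
    (hfib : ∀ (c : K) f, θ f = c • f → ev f = 0 → ev (D f) = 0) :
    ∃ p : K → K, (∀ (c : K) f, θ f = c • f → ev (D f) = p c * ev f) ∧
      ∀ (c c' : K) f f', θ f = c • f → ev f ≠ 0 → θ f' = c' • f' → ev f' ≠ 0 →
        p (c * c') = p c + p c' := by
  have key : ∀ c : K, ∃ r : K, ∀ f, θ f = c • f → ev (D f) = r * ev f := by
    intro c
    by_cases h : ∃ f, θ f = c • f ∧ ev f ≠ 0
    · obtain ⟨f, hf, hf0⟩ := h
      refine ⟨ev (D f) / ev f, fun g hg => ?_⟩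
      -- This combination is an eigenfunction vanishing at the point, so `ev (D g) / ev g` does not
      -- depend on `g`.
      have h1 := hfib c (ev f • g - ev g • f)
        (by rw [map_sub, map_smul, map_smul, hf, hg, smul_sub, smul_comm c, smul_comm c])
        (by simp [mul_comm])
      simp only [map_sub, map_smul, smul_eq_mul] at h1
      field_simp
      linear_combination h1
    · push Not at h
      exact ⟨0, fun g hg => by rw [hfib c g hg (h g hg), zero_mul]⟩
  choose p hp using key
  refine ⟨p, hp, fun c c' f f' hf hf0 hf' hf0' => ?_⟩
  have h1 := hp (c * c') (f * f') (by rw [map_mul, hf, hf', smul_mul_smul_comm])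
  rw [hD, map_add, map_mul, map_mul, map_mul, hp c f hf, hp c' f' hf'] at h1
  have : ev f * ev f' ≠ 0 := mul_ne_zero hf0 hf0'
  apply mul_right_cancel₀ this
  linear_combination -h1

/-- In the situation of `exists_eigenvalue_functional`, if moreover `D` is locally nilpotent, then
the shift of the functional is nonzero as soon as the functional does not vanish. -/
theorem eigenvalue_functional_shift_ne_zero (ev : A →ₐ[K] K) (θ : A ≃ₐ[K] A) (D : Module.End K A)
    (a : K) (hnil : ∀ f, ∃ N : ℕ, (D ^ N) f = 0)
    (hshift : ∀ (c : K) f, θ f = c • f → θ (D f) = (a * c) • D f) (p : K → K)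
    (hp : ∀ (c : K) f, θ f = c • f → ev (D f) = p c * ev f) (P : K)
    (hP : ∀ (c : K) f, θ f = c • f → ev f ≠ 0 → ev (D f) ≠ 0 → p (a * c) = p c + P)
    (c : K) (f : A) (hf : θ f = c • f) (hf0 : ev (D f) ≠ 0) : P ≠ 0 := by
  rintro rfl
  -- With zero shift, each application of `D` multiplies the value at the point by the same nonzero
  -- factor.
  have hall : ∀ k : ℕ, ∃ c' : K, θ ((D ^ k) f) = c' • (D ^ k) f ∧ p c' = p c ∧
      ev ((D ^ k) f) ≠ 0 := by
    have h1 : p c * ev f ≠ 0 := hp c f hf ▸ hf0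
    intro k
    induction k with
    | zero => exact ⟨c, by simpa using hf, rfl, by simpa using right_ne_zero_of_mul h1⟩
    | succ k ih =>
      obtain ⟨c', h2, h3, h4⟩ := ih
      have h5 : ev (D ((D ^ k) f)) ≠ 0 := by
        rw [hp c' _ h2, h3]
        exact mul_ne_zero (left_ne_zero_of_mul h1) h4
      refine ⟨a * c', ?_, ?_, ?_⟩
      · rw [pow_succ', Module.End.mul_apply]
        exact hshift _ _ h2
      · rw [hP c' _ h2 h4 h5, h3, add_zero]
      · rw [pow_succ', Module.End.mul_apply]
        exact h5
  obtain ⟨N, hN⟩ := hnil f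
  obtain ⟨_, _, _, h⟩ := hall N
  exact h (by rw [hN, map_zero])

/-- An `𝔰𝔩₂`-triple of homogeneous derivations which is tangent to the torus orbit at a point has
a nonzero nilpotent combination that vanishes at the point. -/
theorem exists_nilpotent_vanishing [CharZero K] (ev : A →ₐ[K] K) (θ : A ≃ₐ[K] A)
    (hspan : ∀ D : Module.End K A, (∀ (c : K) f, θ f = c • f → ev (D f) = 0) → ∀ f, ev (D f) = 0)
    (E F H : Module.End K A) (a b : K) (hab : a * b = 1)
    (hE : ∀ f g, E (f * g) = f * E g + E f * g) (hF : ∀ f g, F (f * g) = f * F g + F f * g)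
    (hEnil : ∀ f, ∃ N : ℕ, (E ^ N) f = 0) (hFnil : ∀ f, ∃ N : ℕ, (F ^ N) f = 0)
    (hEF : ∀ f, E (F f) - F (E f) = H f) (hHE : ∀ f, H (E f) - E (H f) = (2 : K) • E f)
    (hEshift : ∀ (c : K) f, θ f = c • f → θ (E f) = (a * c) • E f)
    (hFshift : ∀ (c : K) f, θ f = c • f → θ (F f) = (b * c) • F f)
    (hEfib : ∀ (c : K) f, θ f = c • f → ev f = 0 → ev (E f) = 0)
    (hFfib : ∀ (c : K) f, θ f = c • f → ev f = 0 → ev (F f) = 0) :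
    ∃ x y z : K, (x ≠ 0 ∨ y ≠ 0 ∨ z ≠ 0) ∧ y ^ 2 + x * z = 0 ∧
      ∀ f, ev (x • E f + y • H f + z • F f) = 0 := by
  by_cases hE0 : ∀ f, ev (E f) = 0
  · exact ⟨1, 0, 0, by simp, by simp, fun f => by simpa using hE0 f⟩
  by_cases hF0 : ∀ f, ev (F f) = 0
  · exact ⟨0, 0, 1, by simp, by simp, fun f => by simpa using hF0 f⟩
  obtain ⟨c, f, hf, hEf⟩ : ∃ (c : K) (f : A), θ f = c • f ∧ ev (E f) ≠ 0 := by
    by_contra! h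
    exact hE0 (hspan E h)
  obtain ⟨c', f', hf', hFf'⟩ : ∃ (c : K) (f : A), θ f = c • f ∧ ev (F f) ≠ 0 := by
    by_contra! h
    exact hF0 (hspan F h)
  obtain ⟨p, hp, hpadd⟩ := exists_eigenvalue_functional ev θ E hE hEfib
  obtain ⟨q, hq, hqadd⟩ := exists_eigenvalue_functional ev θ F hF hFfib
  have hf0 : ev f ≠ 0 := right_ne_zero_of_mul (hp c f hf ▸ hEf)
  have hf0' : ev f' ≠ 0 := right_ne_zero_of_mul (hq c' f' hf' ▸ hFf')
  have hE' := hEshift c f hf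
  have hF' := hFshift c' f' hf'
  set P := p (a * c) - p c with hP
  set Q := q (a * c) - q c with hQ
  -- `p` and `q` change by `P` and `Q` when the eigenvalue is multiplied by `a`
  have hpshift : ∀ (m : K) g g', θ g = m • g → ev g ≠ 0 → θ g' = (a * m) • g' → ev g' ≠ 0 →
      p (a * m) = p m + P := by
    intro m g g' hg hg0 hg' hg0'
    -- The eigenvalue `a * m * c` belongs both to `g' * f` and to `g * E f`. There may be no
    -- eigenfunction for `a` itself, so additivity cannot be applied to `a` and `m` directly.
    have h1 := hpadd _ _ _ _ hg' hg0' hf hf0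
    have h2 := hpadd _ _ _ _ hg hg0 hE' hEf
    rw [show a * m * c = m * (a * c) by ring] at h1
    rw [hP]
    linear_combination h2 - h1
  have hqshift : ∀ (m : K) g g', θ g = m • g → ev g ≠ 0 → θ g' = (a * m) • g' → ev g' ≠ 0 →
      q (a * m) = q m + Q := by
    intro m g g' hg hg0 hg' hg0'
    have h1 := hqadd _ _ _ _ hg' hg0' hf hf0
    have h2 := hqadd _ _ _ _ hg hg0 hE' hEf
    rw [show a * m * c = m * (a * c) by ring] at h1
    rw [hQ]
    linear_combination h2 - h1
  have hEvE : ∀ (m : K) g, θ g = m • g → ev g ≠ 0 → ev (E g) ≠ 0 → p (a * m) = p m + P ∧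
      q (a * m) = q m + Q := fun m g hg hg0 hg1 =>
    ⟨hpshift m g _ hg hg0 (hEshift m g hg) hg1, hqshift m g _ hg hg0 (hEshift m g hg) hg1⟩
  have habm (m : K) : a * (b * m) = m := by rw [← mul_assoc, hab, one_mul]
  have hEvF : ∀ (m : K) g, θ g = m • g → ev g ≠ 0 → ev (F g) ≠ 0 → p (b * m) = p m - P ∧
      q (b * m) = q m - Q := by
    intro m g hg hg0 hg1
    have h1 := hpshift (b * m) (F g) g (hFshift m g hg) hg1 (by rw [habm, hg]) hg0
    have h2 := hqshift (b * m) (F g) g (hFshift m g hg) hg1 (by rw [habm, hg]) hg0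
    rw [habm] at h1 h2
    exact ⟨by linear_combination -h1, by linear_combination -h2⟩
  have hP0 : P ≠ 0 := eigenvalue_functional_shift_ne_zero ev θ E a hEnil hEshift p hp P
    (fun m g hg hg0 hg1 => (hEvE m g hg hg0 hg1).1) c f hf hEf
  have hQ0 : Q ≠ 0 := by
    have := eigenvalue_functional_shift_ne_zero ev θ F b hFnil hFshift q hq (-Q)
      (fun m g hg hg0 hg1 => by rw [(hEvF m g hg hg0 hg1).2, sub_eq_add_neg]) c' f' hf' hFf'
    simpa using this
  have hH : ∀ (m : K) g, θ g = m • g → ev (H g) = (-P * q m - Q * p m) * ev g := by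
    intro m g hg
    rw [← hEF, map_sub, hp _ _ (hFshift m g hg), hq _ _ (hEshift m g hg)]
    -- The shift formula is available only if `F g` is nonzero at the point; otherwise both sides
    -- vanish.
    have h1 : p (b * m) * ev (F g) = (p m - P) * ev (F g) := by
      by_cases h : ev (F g) = 0
      · rw [h, mul_zero, mul_zero]
      · rw [(hEvF m g hg (right_ne_zero_of_mul (hq m g hg ▸ h)) h).1]
    have h2 : q (a * m) * ev (E g) = (q m + Q) * ev (E g) := by
      by_cases h : ev (E g) = 0
      · rw [h, mul_zero, mul_zero]
      · rw [(hEvE m g hg (right_ne_zero_of_mul (hp m g hg ▸ h)) h).2]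
    rw [h1, h2, hp m g hg, hq m g hg]
    ring
  have hHf : θ (H f) = c • H f := by
    rw [← hEF, map_sub, hEshift _ _ (hFshift c f hf), hFshift _ _ hE', smul_sub,
      show b * (a * c) = c by rw [← mul_assoc, mul_comm b, hab, one_mul], habm]
  have hPQ : P * Q = -1 := by
    -- Evaluated at the point, the relation reads `-2 P Q p(c) f(x) = 2 p(c) f(x)`.
    have h1 := congrArg ev (hHE f)
    rw [map_sub, hH _ _ hE', hp _ _ hHf, hH _ _ hf, map_smul, smul_eq_mul, (hEvE c f hf hf0 hEf).1,
      (hEvE c f hf hf0 hEf).2, hp c f hf] at h1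
    have h2 : p c * ev f ≠ 0 := hp c f hf ▸ hEf
    have h3 : (2 : K) ≠ 0 := two_ne_zero
    apply mul_left_cancel₀ (mul_ne_zero h3 h2)
    linear_combination -h1
  refine ⟨Q, 1, P, by simp, by linear_combination hPQ, ?_⟩
  refine hspan (Q • E + (1 : K) • H + P • F) fun m g hg => ?_
  simp only [LinearMap.add_apply, LinearMap.smul_apply, map_add, map_smul, smul_eq_mul, one_mul]
  rw [hp m g hg, hq m g hg, hH m g hg]
  ring

end Horospherical
-- Weight decomposition and a generic torus element
section TorusWeights

variable {K A M : Type*} [Field K] [CommRing A] [Algebra K A] [AddCommGroup M]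

theorem torusEval_tensor (w : AddMonoidAlgebra K M ⊗[K] A) : ∃ v : M →₀ A, ∀ t : Torus K M,
    Algebra.TensorProduct.lid K A
      (Algebra.TensorProduct.map (torusEval K M t) (AlgHom.id K A) w) =
      v.sum fun m a => (t (Multiplicative.ofAdd m) : K) • a := by
  induction w with
  | zero => exact ⟨0, fun t => by simp⟩
  | add x y hx hy =>
    obtain ⟨v, hv⟩ := hx
    obtain ⟨v', hv'⟩ := hy
    refine ⟨v + v', fun t => ?_⟩
    rw [map_add, map_add, hv, hv', Finsupp.sum_add_index' (by simp) (by simp)]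
  | tmul p a =>
    induction p using AddMonoidAlgebra.induction_linear with
    | zero => exact ⟨0, fun t => by simp⟩
    | add x y hx hy =>
      obtain ⟨v, hv⟩ := hx
      obtain ⟨v', hv'⟩ := hy
      refine ⟨v + v', fun t => ?_⟩
      rw [TensorProduct.add_tmul, map_add, map_add, hv, hv',
        Finsupp.sum_add_index' (by simp) (by simp)]
    | single m r =>
      refine ⟨Finsupp.single m (r • a), fun t => ?_⟩
      rw [Finsupp.sum_single_index (by simp)]
      simp [torusEval, AddMonoidAlgebra.lift_single, smul_smul, mul_comm]

/-- The character lattice of a torus over a field of characteristic zero embeds into `Kˣ` via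
evaluation at a suitable point of the torus. -/
theorem exists_torus_separating (K M : Type*) [Field K] [CharZero K] [AddCommGroup M]
    [Module.Free ℤ M] [Module.Finite ℤ M] : ∃ t : Torus K M, Function.Injective t := by
  let b := Module.finBasis ℤ M
  -- Distinct primes as coordinates of the point: unique factorization separates the characters.
  let P (i : Fin (Module.finrank ℤ M)) : ℚˣ :=
    Units.mk0 (Nat.nth Nat.Prime i : ℚ) (by exact_mod_cast (Nat.prime_nth_prime i).ne_zero)
  let t : Multiplicative M →* ℚˣ :=
    { toFun := fun m => ∏ i, P i ^ (b.repr m.toAdd i)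
      map_one' := by simp
      map_mul' := fun m m' => by
        simp [zpow_add, Finset.prod_mul_distrib] }
  have ht : Function.Injective t := by
    rw [injective_iff_map_eq_one]
    intro m hm
    suffices h : b.repr m.toAdd = 0 by
      have := b.repr.map_eq_zero_iff.mp h
      simpa using this
    ext j
    have hj : Fact (Nat.Prime (Nat.nth Nat.Prime j)) := ⟨Nat.prime_nth_prime j⟩
    have h1 : ∏ i, ((P i : ℚ) ^ (b.repr m.toAdd i)) = 1 := by
      have := congrArg (Units.val) hm
      simpa [t] using this
    have h2 : ∀ s : Finset (Fin (Module.finrank ℤ M)),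
        padicValRat (Nat.nth Nat.Prime j) (∏ i ∈ s, ((P i : ℚ) ^ (b.repr m.toAdd i))) =
          ∑ i ∈ s, b.repr m.toAdd i * padicValRat (Nat.nth Nat.Prime j) (P i : ℚ) := by
      intro s
      induction s using Finset.cons_induction with
      | empty => simp
      | cons i s hi ih =>
        rw [Finset.prod_cons, Finset.sum_cons, padicValRat.mul, ih, padicValRat.zpow]
        · exact zpow_ne_zero _ (P i).ne_zero
        · exact Finset.prod_ne_zero_iff.mpr fun i _ => zpow_ne_zero _ (P i).ne_zero
    have h3 := h2 Finset.univ
    rw [h1, padicValRat.one, Finset.sum_eq_single j] at h3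
    · have h4 : padicValRat (Nat.nth Nat.Prime j) (P j : ℚ) = 1 := by
        simp only [P, Units.val_mk0]
        exact padicValRat.self hj.out.one_lt
      rw [h4, mul_one] at h3
      simpa using h3.symm
    · intro i _ hij
      have hi : Fact (Nat.Prime (Nat.nth Nat.Prime i)) := ⟨Nat.prime_nth_prime i⟩
      have : padicValRat (Nat.nth Nat.Prime j) (P i : ℚ) = 0 := by
        simp only [P, Units.val_mk0]
        rw [padicValRat.of_nat]
        norm_cast
        rw [padicValNat_primes]
        intro h
        apply hij
        have := Nat.nth_injective Nat.infinite_setOfPred_prime h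
        exact (Fin.ext this).symm
      rw [this, mul_zero]
    · simp
  refine ⟨(Units.map (algebraMap ℚ K : ℚ →* K)).comp t, ?_⟩
  exact (Units.map_injective (algebraMap ℚ K).injective).comp ht

variable [IsDomain A]

/-- Distinct characters of a torus are linearly independent, also with coefficients in `A`. -/
theorem torus_weights_independent {t₀ : Torus K M} (ht₀ : Function.Injective t₀) (s : Finset M)
    (g : M → A) (hg : ∀ t : Torus K M, ∑ m ∈ s, (t (Multiplicative.ofAdd m) : K) • g m = 0) :
    ∀ m ∈ s, g m = 0 := by
  let χ (m : M) : Torus K M →* A :=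
    { toFun := fun t => algebraMap K A (t (Multiplicative.ofAdd m))
      map_one' := by simp
      map_mul' := fun t t' => by simp }
  have hχ : Function.Injective χ := by
    intro m m' h
    have h1 := DFunLike.congr_fun h t₀
    have h2 := Units.ext ((algebraMap K A).injective h1)
    exact ht₀ h2
  have hli := (linearIndependent_monoidHom (Torus K M) A).comp χ hχ
  rw [linearIndependent_iff'] at hli
  refine hli s g ?_
  funext t
  rw [Finset.sum_apply, Pi.zero_apply, ← hg t]
  refine Finset.sum_congr rfl fun m _ => ?_
  simp [χ, Algebra.smul_def, mul_comm]

/-- A generic element of the torus acts semisimply, and its eigenfunctions are semi-invariants of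
the torus. -/
theorem exists_generic_torus_element [CharZero K] [Module.Free ℤ M] [Module.Finite ℤ M]
    {τ : Torus K M →* (A ≃ₐ[K] A)} (hτ : IsRegularAction (torusEval K M) τ) :
    ∃ t₀ : Torus K M,
      (∀ f, f ∈ Submodule.span K {g : A | ∃ c : K, τ t₀ g = c • g}) ∧
      (∀ (c : K) y, τ t₀ (τ t₀ y - c • y) = c • (τ t₀ y - c • y) → τ t₀ y = c • y) ∧
      ∀ (c : K) f, τ t₀ f = c • f → ∀ t, ∃ r : K, τ t f = r • f := by
  obtain ⟨c, hc⟩ := hτ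
  obtain ⟨t₀, ht₀⟩ := exists_torus_separating K M
  have h1 : ∀ f : A, ∃ v : M →₀ A, ∀ t : Torus K M,
      τ t⁻¹ f = ∑ m ∈ v.support, (t (Multiplicative.ofAdd m) : K) • v m := by
    intro f
    obtain ⟨v, hv⟩ := torusEval_tensor (c f)
    exact ⟨v, fun t => by rw [← hc, hv]; rfl⟩
  choose v hv using h1
  have hsum : ∀ f, f = ∑ m ∈ (v f).support, v f m := by
    intro f
    have h := hv f 1
    rw [show τ (1 : Torus K M)⁻¹ = 1 from
      (congrArg τ (inv_one (G := Torus K M))).trans τ.map_one] at h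
    simpa using h
  have hweight : ∀ f (t : Torus K M), ∀ m ∈ (v f).support,
      τ t⁻¹ (v f m) = (t (Multiplicative.ofAdd m) : K) • v f m := by
    intro f t m hm
    rw [← sub_eq_zero]
    -- Expand the translate of `f` by `(s * t)⁻¹` in two ways and compare the coefficients of the
    -- characters of `s`.
    refine torus_weights_independent ht₀ (v f).support
      (fun m => τ t⁻¹ (v f m) - (t (Multiplicative.ofAdd m) : K) • v f m) (fun s => ?_) m hm
    have h3 := congrArg (τ t⁻¹) (hv f s)
    rw [← AlgEquiv.mul_apply, ← map_mul,
      show t⁻¹ * s⁻¹ = (s * t)⁻¹ from (mul_inv_rev s t).symm, hv, map_sum] at h3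
    simp only [smul_sub, Finset.sum_sub_distrib]
    rw [sub_eq_zero]
    simp only [map_smul] at h3
    rw [← h3]
    refine Finset.sum_congr rfl fun m _ => ?_
    rw [smul_smul, MonoidHom.mul_apply, Units.val_mul]
  -- a linear relation between the weight components holds for each component
  have hrel : ∀ f (r : M → K), ∑ m ∈ (v f).support, r m • v f m = 0 →
      ∀ m ∈ (v f).support, r m = 0 := by
    intro f r hr m hm
    have h2 := torus_weights_independent ht₀ (v f).support (fun m => r m • v f m) (fun t => by
      have h3 := congrArg (τ t⁻¹) hr
      rw [map_sum, map_zero] at h3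
      rw [← h3]
      refine Finset.sum_congr rfl fun m hm => ?_
      rw [map_smul, hweight f t m hm, smul_comm]) m hm
    exact (smul_eq_zero.mp h2).resolve_right (Finsupp.mem_support_iff.mp hm)
  let χ (m : M) : K := t₀ (Multiplicative.ofAdd m)
  have hχ : ∀ f, τ t₀⁻¹ f = ∑ m ∈ (v f).support, χ m • v f m := fun f => hv f t₀
  have hsub : ∀ (c : K) f, τ t₀⁻¹ f - c • f = ∑ m ∈ (v f).support, (χ m - c) • v f m := by
    intro c f
    conv_lhs => rw [hχ f]; rhs; rw [hsum f, Finset.smul_sum]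
    simp only [sub_smul, Finset.sum_sub_distrib]
  have heig : ∀ (c : K) f, τ t₀⁻¹ f = c • f → ∀ m ∈ (v f).support, χ m = c := by
    intro c f hf m hm
    have := hrel f (fun m => χ m - c) (by rw [← hsub, hf, sub_self]) m hm
    exact sub_eq_zero.mp this
  refine ⟨t₀⁻¹, fun f => ?_, fun c y hy => ?_, fun c f hf t => ?_⟩
  · rw [hsum f]
    exact Submodule.sum_mem _ fun m hm => Submodule.subset_span ⟨_, hweight f t₀ m hm⟩
  -- On the component of weight `m`, the hypothesis says `(χ m - c)² = 0`.
  · have h2 : ∑ m ∈ (v y).support, ((χ m - c) * (χ m - c)) • v y m = 0 := by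
      rw [← sub_eq_zero, hsub c y, map_sum, Finset.smul_sum, ← Finset.sum_sub_distrib] at hy
      rw [← hy]
      refine Finset.sum_congr rfl fun m hm => ?_
      rw [map_smul, hweight y t₀ m hm, smul_smul, smul_smul, ← sub_smul]
      congr 1
      ring
    rw [← sub_eq_zero, hsub c y]
    refine Finset.sum_eq_zero fun m hm => ?_
    rw [mul_self_eq_zero.mp (hrel y _ h2 m hm), zero_smul]
  · by_cases hf0 : f = 0
    · exact ⟨0, by rw [hf0, map_zero, smul_zero]⟩
    obtain ⟨m, hm⟩ : (v f).support.Nonempty := by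
      rw [Finset.nonempty_iff_ne_empty]
      intro h
      apply hf0
      rw [hsum f, h, Finset.sum_empty]
    have huniq : ∀ m' ∈ (v f).support, m' = m := fun m' hm' => by
      have : χ m' = χ m := (heig c f hf m' hm').trans (heig c f hf m hm).symm
      exact ht₀ (Units.ext this)
    have hfm : f = v f m := by
      conv_lhs => rw [hsum f]
      exact Finset.sum_eq_single m (fun m' hm' h => absurd (huniq m' hm') h)
        (fun h => absurd hm h)
    refine ⟨(t⁻¹ (Multiplicative.ofAdd m) : Kˣ), ?_⟩
    have := hweight f t⁻¹ m hm
    rwa [show t⁻¹⁻¹ = t from inv_inv t, ← hfm] at this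

end TorusWeights
-- A homogeneous pair of opposite root vectors
section Homogeneous

variable {K A : Type*} [Field K] [CommRing A] [Algebra K A] [IsDomain A] [IsAlgClosed K]
  [CharZero K] {ρ : SL(2, K) →* (A ≃ₐ[K] A)} {d : Matrix (Fin 2) (Fin 2) K →ₗ[K] Module.End K A}

/-- If a semisimple automorphism normalizes the image of `SL₂`, then a pair of opposite root vectors
of `𝔰𝔩₂` is homogeneous for it, with opposite weights. -/
theorem IsDifferential.exists_homogeneous_triple (hd : IsDifferential ρ d) (hE : d (matE K) ≠ 0)
    {θ : A ≃ₐ[K] A} (hθ : ∀ g, ∃ g', θ * ρ g * θ⁻¹ = ρ g')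
    (hspan : ∀ f, f ∈ Submodule.span K {g : A | ∃ c : K, θ g = c • g})
    (hss : ∀ (c : K) y, θ (θ y - c • y) = c • (θ y - c • y) → θ y = c • y) :
    ∃ (k : SL(2, K)) (a b : K), a * b = 1 ∧
      (∀ f, θ (d (conjMat k (matE K)) f) = a • d (conjMat k (matE K)) (θ f)) ∧
      ∀ f, θ (d (conjMat k (matF K)) f) = b • d (conjMat k (matF K)) (θ f) := by
  obtain ⟨g, hg⟩ := hd.exists_inner hE hθ
  obtain ⟨k, h, rfl, h10, hcases⟩ := exists_conj_triangular g
  have hdet := sl2_det h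
  rw [h10, mul_zero, sub_zero] at hdet
  have hconj : ∀ X : Matrix (Fin 2) (Fin 2) K, X.trace = 0 → ∀ f,
      θ (d (conjMat k X) f) = d (conjMat k (conjMat h X)) (θ f) := by
    intro X hX f
    rw [hg _ ((trace_conjMat k X).trans hX), ← conjMat_mul, inv_mul_cancel_right, conjMat_mul]
  have hhE : conjMat h (matE K) = h 0 0 ^ 2 • matE K := by
    rw [conjMat_matE, h10, matE]
    ext i j
    fin_cases i <;> fin_cases j <;> simp
  by_cases h01 : h 0 1 = 0
  · refine ⟨k, h 0 0 ^ 2, h 1 1 ^ 2, by rw [← mul_pow, hdet, one_pow], fun f => ?_, fun f => ?_⟩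
    · rw [hconj _ matE_nil.1, hhE, conjMat_smul, map_smul, LinearMap.smul_apply]
    · have hhF : conjMat h (matF K) = h 1 1 ^ 2 • matF K := by
        rw [conjMat_matF, h01, matF]
        ext i j
        fin_cases i <;> fin_cases j <;> simp
      rw [hconj _ matF_nil.1, hhF, conjMat_smul, map_smul, LinearMap.smul_apply]
  -- Here `h` is a nontrivial Jordan block, which sends `h`-direction fields to themselves plus a
  -- multiple of the `e`-direction. Semisimplicity of `θ` then makes the field of `k e k⁻¹` kill
  -- every eigenfunction.
  · exfalso
    have h00 := hcases.resolve_right h01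
    have h1 : h 0 0 ≠ 0 := left_ne_zero_of_mul_eq_one hdet
    have hhH : conjMat h (matH K) = matH K - (2 * (h 0 0 * h 0 1)) • matE K := by
      rw [conjMat_matH, h10, matH, matE]
      ext i j
      fin_cases i <;> fin_cases j <;> simp [hdet]
      ring
    have hhE1 : conjMat h (matE K) = matE K := by
      rw [hhE, pow_two]
      nth_rewrite 2 [h00]
      rw [hdet, one_smul]
    apply hd.conjMat_ne_zero hE k
    have hzero : ∀ (c : K) f, θ f = c • f → d (conjMat k (matE K)) f = 0 := by
      intro c f hf
      by_cases hc : c = 0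
      · rw [hc, zero_smul] at hf
        rw [(map_eq_zero_iff _ θ.injective).mp hf, map_zero]
      have hθE : θ (d (conjMat k (matE K)) f) = c • d (conjMat k (matE K)) f := by
        rw [hconj _ matE_nil.1, hhE1, hf, map_smul]
      have hθH : θ (d (conjMat k (matH K)) f) - c • d (conjMat k (matH K)) f =
          (-(2 * (h 0 0 * h 0 1)) * c) • d (conjMat k (matE K)) f := by
        rw [hconj _ (by simp [matH, Matrix.trace_fin_two]), hhH, conjMat_sub, conjMat_smul, map_sub,
          map_smul, hf, map_smul, LinearMap.sub_apply, LinearMap.smul_apply]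
        module
      have h2 := hss c _ (by rw [hθH, map_smul, hθE, smul_comm])
      rw [h2, sub_self] at hθH
      refine (smul_eq_zero.mp hθH.symm).resolve_left ?_
      simp [hc, h1, h01]
    ext f
    rw [LinearMap.zero_apply]
    induction hspan f using Submodule.span_induction with
    | mem f hf => obtain ⟨c, hf⟩ := hf; exact hzero c f hf
    | zero => rw [map_zero]
    | add f g _ _ hf hg => rw [map_add, hf, hg, add_zero]
    | smul a f _ hf => rw [map_smul, hf, smul_zero]

end Homogeneous

/-! ### Maximal unipotent subgroups of `SL₂` -/

section UnipotentSubgroup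

variable {K : Type*} [Field K]

/-- The one-parameter unipotent subgroup of a nilpotent matrix. -/
def unipSubgroup (n : Matrix (Fin 2) (Fin 2) K) (hn : InNilCone n) : Subgroup SL(2, K) where
  carrier := Set.range (unip n hn)
  mul_mem' := by
    rintro _ _ ⟨s, rfl⟩ ⟨r, rfl⟩
    exact ⟨s + r, unip_add n hn s r⟩
  one_mem' := ⟨0, unip_zero n hn⟩
  inv_mem' := by
    rintro _ ⟨s, rfl⟩
    exact ⟨-s, unip_neg n hn s⟩

/-- If `1 + w` lies in a larger unipotent subgroup, unipotency of it and of `(1 + w)(1 + n)` gives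
`tr w = det w = tr (w n) = 0`. After conjugating `n` to `e`, these force `w` to be a multiple of
`e`. -/
theorem maximal_unipSubgroup [IsAlgClosed K] {n : Matrix (Fin 2) (Fin 2) K} (hn : InNilCone n)
    (h0 : n ≠ 0) : Maximal IsUnipotentSubgroup (unipSubgroup n hn) := by
  refine ⟨?_, fun V hV hle v hv => ?_⟩
  · rintro _ ⟨s, rfl⟩
    refine ⟨2, ?_⟩
    rw [coe_unip, add_sub_cancel_left, pow_two, smul_mul_smul_comm, hn.mul_self, smul_zero]
  · have htr : ∀ u ∈ V, ((u : Matrix (Fin 2) (Fin 2) K) - 1).trace = 0 := fun u hu =>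
      (Matrix.isNilpotent_trace_of_isNilpotent (hV u hu)).eq_zero
    set w := (v : Matrix (Fin 2) (Fin 2) K) - 1 with hw
    have hvw : (v : Matrix (Fin 2) (Fin 2) K) = 1 + w := by rw [hw, add_sub_cancel]
    have hwtr : w.trace = 0 := htr v hv
    have hwdet : w.det = 0 := by
      have h1 := v.det_coe
      rw [hvw, Matrix.det_fin_two] at h1
      rw [Matrix.trace_fin_two] at hwtr
      rw [Matrix.det_fin_two]
      simp at h1
      linear_combination h1 - hwtr
    have hwn : (w * n).trace = 0 := by
      have h1 := htr _ (V.mul_mem hv (hle ⟨1, rfl⟩ : unip n hn 1 ∈ V))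
      rw [Matrix.SpecialLinearGroup.coe_mul, coe_unip, hvw, one_smul,
        show (1 + w) * (1 + n) - 1 = w + n + w * n by noncomm_ring, Matrix.trace_add,
        Matrix.trace_add, hwtr, hn.1, zero_add, zero_add] at h1
      exact h1
    obtain ⟨g, hg⟩ := hn.exists_eq_conjMat h0
    obtain ⟨w', hw'⟩ : ∃ w', w = conjMat g w' :=
      ⟨conjMat g⁻¹ w, by rw [← conjMat_mul, mul_inv_cancel, conjMat_one]⟩
    rw [hw', trace_conjMat, Matrix.trace_fin_two] at hwtr
    rw [hw', det_conjMat, Matrix.det_fin_two] at hwdet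
    rw [hw', hg, ← conjMat_matMul, trace_conjMat, Matrix.trace_fin_two] at hwn
    have h10 : w' 1 0 = 0 := by simpa [matE, Matrix.mul_apply, Fin.sum_univ_two] using hwn
    have h11 : w' 1 1 = -w' 0 0 := by linear_combination hwtr
    have h00 : w' 0 0 = 0 := by
      rw [h10, h11] at hwdet
      apply mul_self_eq_zero.mp
      linear_combination -hwdet
    refine ⟨w' 0 1, ?_⟩
    apply Subtype.ext
    change (unip n hn (w' 0 1) : Matrix (Fin 2) (Fin 2) K) = v
    rw [coe_unip, hvw, hw', hg, ← conjMat_smul]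
    congr 2
    rw [matE]
    ext i j
    fin_cases i <;> fin_cases j <;> simp [h10, h11, h00]

end UnipotentSubgroup

/-! ### Closed points and the Zariski topology -/

section Points

/-- Evaluation of functions at a point (the Nullstellensatz). -/
theorem exists_evaluation (K : Type*) {A : Type*} [Field K] [IsAlgClosed K] [CommRing A]
    [Algebra K A] [Algebra.FiniteType K A] (x : MaximalSpectrum A) :
    ∃ ev : A →ₐ[K] K, ∀ f, ev f = 0 ↔ f ∈ x.asIdeal := by
  have hx := x.isMaximal
  let _ : Field (A ⧸ x.asIdeal) := Ideal.Quotient.field x.asIdeal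
  have : Algebra.FiniteType K (A ⧸ x.asIdeal) :=
    Algebra.FiniteType.of_surjective (Ideal.Quotient.mkₐ K x.asIdeal)
      (Ideal.Quotient.mkₐ_surjective K x.asIdeal)
  have : Module.Finite K (A ⧸ x.asIdeal) := finite_of_finite_type_of_isJacobsonRing _ _
  let e : K ≃ₐ[K] A ⧸ x.asIdeal := AlgEquiv.ofBijective (Algebra.ofId K (A ⧸ x.asIdeal))
    (IsAlgClosed.algebraMap_bijective_of_isIntegral (k := K) (K := A ⧸ x.asIdeal))
  refine ⟨e.symm.toAlgHom.comp (Ideal.Quotient.mkₐ K x.asIdeal), fun f => ?_⟩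
  change e.symm (Ideal.Quotient.mk x.asIdeal f) = 0 ↔ _
  rw [map_eq_zero_iff _ e.symm.injective, Ideal.Quotient.eq_zero_iff_mem]

/-- Nonempty open subsets of an irreducible affine variety are dense. -/
theorem dense_of_isOpen (K : Type*) {A : Type*} [Field K] [CommRing A] [Algebra K A]
    [Algebra.FiniteType K A] [IsDomain A] {W : Set (MaximalSpectrum A)} (hW : IsOpen W)
    (hne : W.Nonempty) : Dense W := by
  have hbasic : ∀ V : Set (MaximalSpectrum A), IsOpen V → V.Nonempty →
      ∃ f : A, f ≠ 0 ∧ ∀ x : MaximalSpectrum A, f ∉ x.asIdeal → x ∈ V := by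
    rintro V hV ⟨x, hx⟩
    obtain ⟨V', hV', rfl⟩ := isOpen_induced_iff.mp hV
    obtain ⟨_, ⟨f, rfl⟩, hxf, hfV⟩ :=
      PrimeSpectrum.isTopologicalBasis_basic_opens.exists_subset_of_mem_open hx hV'
    refine ⟨f, ?_, fun y hy => hfV hy⟩
    rintro rfl
    exact hxf (zero_mem _)
  rw [dense_iff_inter_open]
  intro V hV hVne
  obtain ⟨f, hf0, hf⟩ := hbasic V hV hVne
  obtain ⟨g, hg0, hg⟩ := hbasic W hW hne
  -- In a Jacobson domain the maximal ideals intersect in zero, so one of them avoids `f * g`.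
  have hJ : IsJacobsonRing A := isJacobsonRing_of_finiteType (A := K)
  have hbot : (⊥ : Ideal A).jacobson = ⊥ := hJ.out (Ideal.isPrime_bot.isRadical)
  have hfg : f * g ∉ (⊥ : Ideal A).jacobson := by
    rw [hbot, Ideal.mem_bot]
    exact mul_ne_zero hf0 hg0
  rw [Ideal.jacobson, Ideal.mem_sInf] at hfg
  push Not at hfg
  obtain ⟨I, ⟨_, hI⟩, hfgI⟩ := hfg
  exact ⟨⟨I, hI⟩, hf _ fun h => hfgI (I.mul_mem_right g h),
    hg _ fun h => hfgI (I.mul_mem_left f h)⟩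

theorem mem_asIdeal_of_mem_closure {A : Type*} [CommRing A] {f : A} {S : Set (MaximalSpectrum A)}
    (hS : ∀ y ∈ S, f ∈ y.asIdeal) {z : MaximalSpectrum A} (hz : z ∈ closure S) :
    f ∈ z.asIdeal := by
  have hc : IsClosed {y : MaximalSpectrum A | f ∈ y.asIdeal} := by
    have := (PrimeSpectrum.isClosed_zeroLocus ({f} : Set A)).preimage
      MaximalSpectrum.toPrimeSpectrum_continuous
    convert this using 1
    ext y
    simp [PrimeSpectrum.mem_zeroLocus, MaximalSpectrum.toPrimeSpectrum]
  exact closure_minimal hS hc hz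

end Points
-- From vanishing tangent fields to isotropy
section Special

variable {K A M : Type*} [Field K] [IsAlgClosed K] [CharZero K] [CommRing A] [IsDomain A]
  [Algebra K A]

section

variable {ρ : SL(2, K) →* (A ≃ₐ[K] A)} {d : Matrix (Fin 2) (Fin 2) K →ₗ[K] Module.End K A}
  (hd : IsDifferential ρ d) {n : Matrix (Fin 2) (Fin 2) K} (hn : InNilCone n)
include hd hn

/-- If a function vanishes on the `SL₂`-orbit of a point, then its derivatives along tangent fields
vanish at the point. -/
theorem IsDifferential.apply_eq_zero (ev : A →ₐ[K] K) {f : A} (hf : ∀ g, ev (ρ g f) = 0) :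
    ev (d n f) = 0 := by
  have h : (hd.poly hn f).map (ev : A →+* K) = 0 := by
    apply Polynomial.funext
    intro s
    have h1 := Polynomial.eval_map_apply (f := (ev : A →+* K)) (p := hd.poly hn f)
      (algebraMap K A s)
    rw [hd.eval_poly] at h1
    simpa [hf] using h1
  rw [← hd.coeff_one_poly hn]
  simpa using congrArg (fun p => Polynomial.coeff p 1) h

/-- If a tangent field of a one-parameter unipotent subgroup vanishes at a point, then the subgroup
fixes the point. -/
theorem IsDifferential.unip_sub_self_eq_zero (ev : A →ₐ[K] K) (hev : ∀ f, ev (d n f) = 0) (s : K)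
    (f : A) : ev (ρ (unip n hn s) f) = ev f := by
  have hcoeff : ∀ k : ℕ, ∀ f, ev ((hd.poly hn f).coeff (k + 1)) = 0 := by
    intro k
    induction k with
    | zero => intro f; rw [zero_add, hd.coeff_one_poly, hev]
    | succ k ih =>
      intro f
      -- The coefficient of index `k + 1` for `d n f` is `k + 2` times that of index `k + 2` for
      -- `f`, and `k + 2` is invertible.
      have h1 := ih (d n f)
      rw [← hd.derivative_poly, Polynomial.coeff_derivative, map_mul] at h1
      refine (mul_eq_zero.mp h1).resolve_right ?_
      rw [map_add, map_natCast, map_one]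
      exact_mod_cast Nat.succ_ne_zero (k + 1)
  have h : (hd.poly hn f).map (ev : A →+* K) = Polynomial.C (ev f) := by
    ext k
    cases k with
    | zero => simp [hd.coeff_zero_poly]
    | succ k => simpa [Polynomial.coeff_C] using hcoeff k f
  have h1 := Polynomial.eval_map_apply (f := (ev : A →+* K)) (p := hd.poly hn f)
    (algebraMap K A s)
  rw [hd.eval_poly, h, Polynomial.eval_C] at h1
  exact h1.symm

theorem IsDifferential.unipSubgroup_le_isotropy {x : MaximalSpectrum A} (ev : A →ₐ[K] K)
    (hx : ∀ f, ev f = 0 ↔ f ∈ x.asIdeal) (hev : ∀ f, ev (d n f) = 0) :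
    unipSubgroup n hn ≤ isotropy ρ x := by
  rintro _ ⟨s, rfl⟩
  change ρ (unip n hn s) • x = x
  apply MaximalSpectrum.ext
  ext f
  rw [mem_smul_iff, ← map_inv, ← unip_neg, ← hx, ← hx, hd.unip_sub_self_eq_zero hn ev hev]

end

variable [AddCommGroup M] [Module.Free ℤ M] [Module.Finite ℤ M]

/-- At a point where the `SL₂`-orbit is contained in the closure of the torus orbit, the tangent
field of some one-parameter unipotent subgroup vanishes. -/
theorem exists_tangent_field_vanishing {τ : Torus K M →* (A ≃ₐ[K] A)}
    (hτ : IsRegularAction (torusEval K M) τ) {ρ : SL(2, K) →* (A ≃ₐ[K] A)}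
    (hnorm : τ.range ≤ Subgroup.normalizer (ρ.range : Set (A ≃ₐ[K] A)))
    {d : Matrix (Fin 2) (Fin 2) K →ₗ[K] Module.End K A} (hd : IsDifferential ρ d)
    {x : MaximalSpectrum A}
    (hx : MulAction.orbit ρ.range x ⊆ closure (MulAction.orbit τ.range x)) (ev : A →ₐ[K] K)
    (hev : ∀ f, ev f = 0 ↔ f ∈ x.asIdeal) :
    ∃ n, InNilCone n ∧ n ≠ 0 ∧ ∀ f, ev (d n f) = 0 := by
  have hE0 : matE K ≠ 0 := fun h => by simpa [matE] using congrFun (congrFun h 0) 1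
  by_cases hE : d (matE K) = 0
  · exact ⟨matE K, matE_nil, hE0, fun f => by rw [hE, LinearMap.zero_apply, map_zero]⟩
  obtain ⟨t₀, hspan, hss, hsemi⟩ := exists_generic_torus_element hτ
  have hθ : ∀ g, ∃ g', τ t₀ * ρ g * (τ t₀)⁻¹ = ρ g' := by
    intro g
    have h1 := (Subgroup.mem_normalizer_iff.mp (hnorm ⟨t₀, rfl⟩) (ρ g)).mp ⟨g, rfl⟩
    obtain ⟨g', hg'⟩ := h1
    exact ⟨g', hg'.symm⟩
  obtain ⟨k, a, b, hab, hkE, hkF⟩ := hd.exists_homogeneous_triple hE hθ hspan hss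
  have hEn := (matE_nil (K := K)).conjMat k
  have hFn := (matF_nil (K := K)).conjMat k
  -- This is the only use of the orbit condition: `f` is a semi-invariant, so its zero at `x`
  -- spreads to the torus orbit, its closure, and the `SL₂`-orbit.
  have hfib : ∀ (c : K) f, τ t₀ f = c • f → ev f = 0 → ∀ n, InNilCone n → ev (d n f) = 0 := by
    intro c f hf hf0 n hn
    apply hd.apply_eq_zero hn
    intro g
    have h1 : f ∈ (ρ g⁻¹ • x).asIdeal := by
      refine mem_asIdeal_of_mem_closure (S := MulAction.orbit τ.range x) ?_
        (hx ⟨⟨ρ g⁻¹, g⁻¹, rfl⟩, rfl⟩)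
      rintro _ ⟨⟨_, t, rfl⟩, rfl⟩
      change f ∈ (τ t • x).asIdeal
      obtain ⟨r, hr⟩ := hsemi c f hf t⁻¹
      rw [mem_smul_iff, ← hev, ← map_inv τ]
      change ev (τ t⁻¹ f) = 0
      rw [hr, map_smul, hf0, smul_zero]
    rw [mem_smul_iff, ← hev, ← map_inv, inv_inv] at h1
    exact h1
  have hH0 : (conjMat k (matH K)).trace = 0 := by
    rw [trace_conjMat]; simp [matH, Matrix.trace_fin_two]
  have hEF : matE K * matF K - matF K * matE K = matH K := by
    ext i j
    fin_cases i <;> fin_cases j <;> simp [matE, matF, matH]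
  have hEH : matE K * matH K - matH K * matE K = (-2 : K) • matE K := by
    ext i j
    fin_cases i <;> fin_cases j <;> simp [matE, matH]
    norm_num
  obtain ⟨r, y, z, hne, hdet, hzero⟩ := exists_nilpotent_vanishing ev (τ t₀)
    (fun D hD f => by
      induction hspan f using Submodule.span_induction with
      | mem f hf => obtain ⟨c, hf⟩ := hf; exact hD c f hf
      | zero => rw [map_zero, map_zero]
      | add f g _ _ hf hg => rw [map_add, map_add, hf, hg, add_zero]
      | smul a f _ hf => rw [map_smul, map_smul, hf, smul_zero])
    (d (conjMat k (matE K))) (d (conjMat k (matF K))) (d (conjMat k (matH K))) a b hab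
    (hd.leibniz hEn) (hd.leibniz hFn) (hd.locally_nilpotent hEn) (hd.locally_nilpotent hFn)
    (fun f => by
      rw [hd.lie_apply hEn hFn.1, ← conjMat_matMul, ← conjMat_matMul, ← conjMat_sub, hEF])
    (fun f => by
      rw [← neg_sub, hd.lie_apply hEn hH0, ← conjMat_matMul, ← conjMat_matMul, ← conjMat_sub, hEH,
        conjMat_smul, map_smul, LinearMap.smul_apply, neg_smul, neg_neg])
    (fun c f hf => by rw [hkE, hf, map_smul, smul_smul])
    (fun c f hf => by rw [hkF, hf, map_smul, smul_smul])
    (fun c f hf hf0 => hfib c f hf hf0 _ hEn) (fun c f hf hf0 => hfib c f hf hf0 _ hFn)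
  have hN : r • matE K + y • matH K + z • matF K = !![y, r; z, -y] := by
    ext i j
    fin_cases i <;> fin_cases j <;> simp [matE, matH, matF]
  have hNnil : InNilCone (r • matE K + y • matH K + z • matF K) := by
    rw [hN]
    refine ⟨by simp [Matrix.trace_fin_two], ?_⟩
    rw [Matrix.det_fin_two_of]
    linear_combination -hdet
  refine ⟨_, hNnil.conjMat k, fun h => ?_, fun f => ?_⟩
  · have h1 := congrArg (conjMat k⁻¹) h
    rw [← conjMat_mul, inv_mul_cancel, conjMat_one, conjMat, mul_zero, zero_mul, hN] at h1
    have h2 : r = 0 := by simpa using congrFun (congrFun h1 0) 1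
    have h3 : y = 0 := by simpa using congrFun (congrFun h1 0) 0
    have h4 : z = 0 := by simpa using congrFun (congrFun h1 1) 0
    simp [h2, h3, h4] at hne
  · rw [← hzero f]
    simp only [conjMat_add, conjMat_smul, map_add, map_smul, LinearMap.add_apply,
      LinearMap.smul_apply]

variable [Algebra.FiniteType K A]

/-- The argument is pointwise, so the open set witnessing fiber type also witnesses specialness. -/
theorem IsFiberType.isSpecial {τ : Torus K M →* (A ≃ₐ[K] A)}
    (hτ : IsRegularAction (torusEval K M) τ) {ρ : SL(2, K) →* (A ≃ₐ[K] A)}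
    (hρ : IsRegularAction (sl2Eval K) ρ)
    (hnorm : τ.range ≤ Subgroup.normalizer (ρ.range : Set (A ≃ₐ[K] A)))
    (hfib : IsFiberType τ ρ) : IsSpecial ρ := by
  obtain ⟨d, hd⟩ := exists_isDifferential hρ
  obtain ⟨W, hWo, hWd, hW⟩ := hfib
  refine ⟨W, hWo, hWd, fun x hx => ?_⟩
  obtain ⟨ev, hev⟩ := exists_evaluation K x
  obtain ⟨n, hn, hn0, hvan⟩ := exists_tangent_field_vanishing hτ hnorm hd (hW x hx) ev hev
  exact ⟨unipSubgroup n hn, maximal_unipSubgroup hn hn0,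
    hd.unipSubgroup_le_isotropy hn ev hev hvan⟩

end Special

/-- On a toric variety, every `SL₂`-action is of fiber type. -/
theorem HasOpenOrbit.isFiberType {K A M : Type*} [Field K] [CommRing A] [IsDomain A] [Algebra K A]
    [Algebra.FiniteType K A] [AddCommGroup M] {τ : Torus K M →* (A ≃ₐ[K] A)}
    (h : HasOpenOrbit τ) (ρ : SL(2, K) →* (A ≃ₐ[K] A)) : IsFiberType τ ρ := by
  obtain ⟨x, hx⟩ := h
  have hdense := dense_of_isOpen K hx (MulAction.nonempty_orbit x)
  refine ⟨_, hx, hdense, fun y hy => ?_⟩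
  rw [MulAction.orbit_eq_iff.mpr hy, hdense.closure_eq]
  exact Set.subset_univ _

end AffineAction

theorem proposition3p5
    {K A M : Type*} [Field K] [IsAlgClosed K] [CharZero K]
    -- the normal affine variety `X = Spec A`
    [CommRing A] [IsDomain A] [IsIntegrallyClosed A] [Algebra K A] [Algebra.FiniteType K A]
    -- the character lattice of the torus
    [AddCommGroup M] [Module.Free ℤ M] [Module.Finite ℤ M]
    -- an effective regular action of the torus on `X`
    (τ : AffineAction.Torus K M →* (A ≃ₐ[K] A))
    (hτ : AffineAction.IsRegularAction (AffineAction.torusEval K M) τ)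
    (hτeff : Function.Injective τ)
    -- a compatible regular action of `SL₂` on `X`
    (ρ : SL(2, K) →* (A ≃ₐ[K] A))
    (hρ : AffineAction.IsRegularAction (AffineAction.sl2Eval K) ρ)
    (hcomp : AffineAction.IsCompatible τ ρ) :
    (AffineAction.IsFiberType τ ρ → AffineAction.IsSpecial ρ) ∧
      (AffineAction.HasOpenOrbit τ → AffineAction.IsSpecial ρ) :=
  ⟨AffineAction.IsFiberType.isSpecial hτ hρ hcomp.1, fun h =>
    AffineAction.IsFiberType.isSpecial hτ hρ hcomp.1 (h.isFiberType ρ)⟩
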